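/- Let $F$ be a Minkowski norm on $\mathbb R^n$: an even, convex, $1$-homogeneous function, smooth and positive on $\mathbb R^n\setminus\{0\}$, with $D^2(\tfrac12F^2)$ positive definite on $\mathbb R^n\setminus\{0\}$. Write $F_\xi$ for its gradient. Let $\Omega\subset\mathbb R^n$ be open. A function $u\in C^{0,1}_{\mathrm{loc}}(\Omega)$ is a *weak solution* of $\operatorname{div}(F_\xi(\nabla u))=F(\nabla u)$ in $\Omega$ if for every compact $K\subset\Omega$ and every $\varphi\in C^{0,1}_{\mathrm{loc}}(\Omega)$ with $\varphi=u$ in $\Omega\setminus K$, $$\int_K\big[F(\nabla u)+uF(\nabla u)\big]\,dx\le\int_K\big[F(\nabla\varphi)+\varphi F(\nabla u)\big]\,dx .$$ Let $E_0\subset\mathbb R^n$ be an open set with smooth boundary. We say that $u$ is a *weak solution with initial condition* $E_0$ if $u\in C^{0,1}_{\mathrm{loc}}(\mathbb R^n)$, $E_0=\{u<0\}$, and $u$ is a weak solution in $\mathbb R^n\setminus\overline{E_0}$. Let $N=\partial E$ be a hypersurface with locally finite $\mathcal H^{n-1}$-measure which, at $\mathcal H^{n-1}$-a.e. of its points (that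 is, off a small singular set), has an outer unit normal $\nu$ with respect to $E$, in the sense that for every $\varepsilon>0$ and all $y$ near $x$: $y\in E$ if $\langle\nu(x),y-x\rangle<-\varepsilon|y-x|$, and $y\notin E$ if $\langle\nu(x),y-x\rangle>\varepsilon|y-x|$. Put $\nu_F=F_\xi(\nu)$ and $\operatorname{div}_{F,N}V=\operatorname{div}V-\langle\nabla_{\nu_F}V,\nu/F(\nu)\rangle$. A locally integrable function $H_F$ on $N$ is a *weak anisotropic mean curvature* of $N$ if $$\int_N \operatorname{div}_{F,N}(V)\,F(\nu)\,d\mathcal H^{n-1}=\int_N H_F\,\langle V,\nu\rangle\,d\mathcal H^{n-1}\qquad\text{for all }V\in C_c^\infty(\mathbb R^n;\mathbb R^n).$$ **Proposition.** Let $u$ be a weak solution with initial condition $E_0$, and let $E_t=\{u<t\}$, $N_t=\partial E_t$. Then for a.e. $t>0$ the following holds: $N_t$ has locally finite $\mathcal H^{n-1}$-measure and an outer unit normal with respect to $E_t$ at $\mathcal H^{n-1}$-a.e. point, $u$ is differentiable at $\mathcal H^{n-1}$-a.e. point of $N_t$, and $N_t$ has a weak anisotropic mean curvature $H_F$, which is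 unique up to $\mathcal H^{n-1}$-null sets and satisfies $$H_F=F(\nabla u)\qquad \mathcal H^{n-1}\text{-a.e. on }N_t .$$ -/

import Mathlib

open MeasureTheory Set Filter
open scoped Topology ContDiff

noncomputable section

namespace IAMCF

/-- The Euclidean space `ℝⁿ`. -/
abbrev Space (n : ℕ) : Type := EuclideanSpace ℝ (Fin n)

/-- A Minkowski norm on `ℝⁿ`: an even, convex, positively `1`-homogeneous function, positive and
smooth away from the origin, such that `D² (F² / 2)` is positive definite away from the origin. -/
structure IsMinkowskiNorm {n : ℕ} (F : Space n → ℝ) : Prop where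
  smooth : ContDiffOn ℝ ∞ F {0}ᶜ
  convex : ConvexOn ℝ univ F
  even : ∀ ξ, F (-ξ) = F ξ
  homogeneous : ∀ (r : ℝ) (ξ : Space n), 0 ≤ r → F (r • ξ) = r * F ξ
  pos : ∀ ξ, ξ ≠ 0 → 0 < F ξ
  elliptic : ∀ ξ, ξ ≠ 0 → ∀ v, v ≠ 0 →
    0 < fderiv ℝ (fderiv ℝ fun η : Space n => F η ^ 2 / 2) ξ v v

/-- The functional `J_{F,u}(φ) = ∫_K (F(∇φ) + φ F(∇u)) dx`. For functions that are locally
Lipschitz near `K` the (classical) gradients exist almost everywhere on `K`. -/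
def energy {n : ℕ} (F : Space n → ℝ) (u : Space n → ℝ) (K : Set (Space n))
    (φ : Space n → ℝ) : ℝ :=
  ∫ x in K, (F (gradient φ x) + φ x * F (gradient u x))

/-- `u` is a weak solution of `div (F_ξ(∇u)) = F(∇u)` in the open set `Ω`: it is locally Lipschitz
in `Ω` and `J_{F,u}(u) ≤ J_{F,u}(φ)` for every locally Lipschitz competitor `φ` that agrees with
`u` in `Ω` outside a compact subset `K` of `Ω`. Only the values in `Ω` matter. -/
def IsWeakSolution {n : ℕ} (F : Space n → ℝ) (Ω : Set (Space n)) (u : Space n → ℝ) : Prop :=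
  LocallyLipschitzOn Ω u ∧
    ∀ K : Set (Space n), IsCompact K → K ⊆ Ω →
      ∀ φ : Space n → ℝ, LocallyLipschitzOn Ω φ → (∀ x ∈ Ω \ K, φ x = u x) →
        energy F u K u ≤ energy F u K φ

/-- `E` is an open set with smooth boundary: near each boundary point it is a sublevel set
`{g < 0}` of a smooth function `g` without critical points. -/
def IsOpenWithSmoothBoundary {n : ℕ} (E : Set (Space n)) : Prop :=
  IsOpen E ∧ ∀ x ∈ frontier E, ∃ (U : Set (Space n)) (g : Space n → ℝ),
    IsOpen U ∧ x ∈ U ∧ ContDiffOn ℝ ∞ g U ∧ (∀ y ∈ U, fderiv ℝ g y ≠ 0) ∧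
      ∀ y ∈ U, y ∈ E ↔ g y < 0

/-- `u` is a weak solution of `div (F_ξ(∇u)) = F(∇u)` with initial condition `E₀`. -/
structure IsWeakSolutionWithInitialCondition {n : ℕ} (F : Space n → ℝ) (E₀ : Set (Space n))
    (u : Space n → ℝ) : Prop where
  smoothBoundary : IsOpenWithSmoothBoundary E₀
  locallyLipschitz : LocallyLipschitz u
  initial : E₀ = {x | u x < 0}
  weakSolution : IsWeakSolution F (closure E₀)ᶜ u

/-- The `(n-1)`-dimensional Hausdorff measure on `N ⊆ ℝⁿ`. (Mathlib's `μH` is normalized up to a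
positive constant factor depending on `n` only, which is irrelevant for everything below.) -/
def surfaceMeasure {n : ℕ} (N : Set (Space n)) : Measure (Space n) :=
  (Measure.hausdorffMeasure ((n : ℝ) - 1)).restrict N

/-- `ν` is the outer unit normal of `E` at `x`: for every `ε > 0`, close to `x` the open cone
`{⟨ν, y - x⟩ < -ε |y - x|}` is contained in `E` and the open cone `{⟨ν, y - x⟩ > ε |y - x|}` is
contained in the complement of `E`. Such a `ν` is unique, and at a point where `∂E` is a `C¹`
hypersurface with `E` on one side of it, it is the usual outer unit normal. -/
def IsOuterUnitNormal {n : ℕ} (E : Set (Space n)) (x ν : Space n) : Prop :=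
  ‖ν‖ = 1 ∧ ∀ ε : ℝ, 0 < ε → ∀ᶠ y in 𝓝 x,
    (inner ℝ ν (y - x) < -(ε * ‖y - x‖) → y ∈ E) ∧
    (ε * ‖y - x‖ < inner ℝ ν (y - x) → y ∉ E)

/-- The divergence of a vector field on `ℝⁿ`. -/
def divergence {n : ℕ} (V : Space n → Space n) (x : Space n) : ℝ :=
  ∑ i, (fderiv ℝ V x (EuclideanSpace.single i 1)) i

/-- The anisotropic tangential divergence at `x` with respect to the unit normal `ν`:
`div_{F,N} V = div V - ⟨∇_{ν_F} V, ν / F(ν)⟩`, where `ν_F = F_ξ(ν)`. -/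
def tangentialDivergence {n : ℕ} (F : Space n → ℝ) (V : Space n → Space n)
    (x ν : Space n) : ℝ :=
  divergence V x - inner ℝ (fderiv ℝ V x (gradient F ν)) ((F ν)⁻¹ • ν)

/-- `H` is a weak anisotropic mean curvature of the hypersurface `N = ∂E`. The hypersurface has
locally finite `(n-1)`-dimensional Hausdorff measure and may have a singular set of
`(n-1)`-dimensional measure zero, off which the outer unit normal `ν` exists; the function `H` is
locally integrable on `N`, and
`∫_N div_{F,N}(V) F(ν) = ∫_N H ⟨V, ν⟩` for every smooth compactly supported vector field `V`. -/
def IsWeakAnisotropicMeanCurvature {n : ℕ} (F : Space n → ℝ) (E : Set (Space n))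
    (H : Space n → ℝ) : Prop :=
  IsLocallyFiniteMeasure (surfaceMeasure (frontier E)) ∧
  LocallyIntegrable H (surfaceMeasure (frontier E)) ∧
  ∃ ν : Space n → Space n,
    AEStronglyMeasurable ν (surfaceMeasure (frontier E)) ∧
    (∀ᵐ x ∂(surfaceMeasure (frontier E)), IsOuterUnitNormal E x (ν x)) ∧
    ∀ V : Space n → Space n, ContDiff ℝ ∞ V → HasCompactSupport V →
      ∫ x, tangentialDivergence F V x (ν x) * F (ν x) ∂(surfaceMeasure (frontier E)) =
        ∫ x, H x * inner ℝ (V x) (ν x) ∂(surfaceMeasure (frontier E))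

end IAMCF

end

open scoped ENNReal NNReal

/-! The functional is minimised by `u`, and it is tested with inner variations: competitors `u ∘ (id
+ sW)⁻¹` for a compactly supported Lipschitz field `W`. Moving the graph sideways, rather than
adding a multiple of a test function, avoids differentiating `F` at `∇u = 0`, where it may have no
derivative: after the change of variables, the density `F((1 + sDW)⁻ᵀ∇u) |det(1 + sDW)|` is
identically zero there. Differentiating at `s = 0` gives `∫ F(∇u) tr DW - ⟨∇u, DW F_ξ(∇u)⟩ -
F(∇u)⟨∇u, W⟩ = 0`.

Now take `W = ψ(u)V` with `V` smooth and `ψ` a test function on `(0, ∞)`. The terms containing `ψ'`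
are `ψ'(u)⟨∇u, V⟩(F(∇u) - ⟨∇u, F_ξ(∇u)⟩)`, and they vanish by Euler's identity. Since `F` is
homogeneous of degree one and `F_ξ` of degree zero, what remains is `|∇u| ψ(u)` times the difference
of the two integrands in the definition of weak curvature, with `ν = ∇u/|∇u|` and `H_F = F(∇u)`. The
coarea formula turns this into `∫ ψ(t) (∫_{u = t} …) dt = 0`, so the inner integral vanishes for
almost every `t > 0`. A countable family of fields, dense in the `C¹` sense, makes the exceptional
set of `t` independent of `V`.

The geometric input is that, for almost every `t`, the points of `{u = t}` where `u` is not
differentiable or has zero gradient are `H^{n-1}`-null. Elsewhere differentiability itself yields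
the outer normal, and `∂{u < t}` agrees with `{u = t}` up to a null set. This and the coarea formula
for locally Lipschitz functions are proved from Eilenberg's inequality and from Fubini's theorem on
pieces where `u` is nearly linear.

The pillars are `coarea_of_subset_regularPoints`, `ae_hausdorffMeasure_level_diff_regularPoints`,
`IsMinkowskiNorm.integral_firstVariation_eq_zero`, `IsMinkowskiNorm.firstVariation_comp_smul` and
`IsWeakAnisotropicMeanCurvature.ae_eq`. -/

namespace IAMCF

/-! ### Eilenberg's inequality -/

/-- Eilenberg's inequality for the slices of a set by the level sets of a Lipschitz function, with
a measurable majorant of the (possibly non-measurable) slice function. -/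
theorem exists_measurable_majorant_hausdorffMeasure_slice {X : Type*} [MetricSpace X]
    [MeasurableSpace X] [BorelSpace X] {f : X → ℝ} {A : Set X} {K : ℝ≥0}
    (hf : LipschitzOnWith K f A) {d : ℝ} (hd : 0 ≤ d) (hA : Measure.hausdorffMeasure (d + 1) A ≠ ⊤) :
    ∃ g : ℝ → ℝ≥0∞, Measurable g ∧
      (∀ t, Measure.hausdorffMeasure d (A ∩ {x | f x = t}) ≤ g t) ∧
      ∫⁻ t, g t ≤ K * Measure.hausdorffMeasure (d + 1) A := by
  set M := Measure.hausdorffMeasure (d + 1) A with hM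
  have hcover : ∀ j : ℕ, ∃ t : ℕ → Set X, A ⊆ ⋃ i, t i ∧
      (∀ i, Metric.ediam (t i) ≤ (j + 1 : ℝ≥0∞)⁻¹) ∧
      ∑' i, (⨆ _ : (t i).Nonempty, Metric.ediam (t i) ^ (d + 1)) ≤ M + (j + 1 : ℝ≥0∞)⁻¹ := by
    intro j
    have hj : (0 : ℝ≥0∞) < (j + 1 : ℝ≥0∞)⁻¹ := by
      rw [ENNReal.inv_pos]; exact ENNReal.add_ne_top.2 ⟨ENNReal.natCast_ne_top j, ENNReal.one_ne_top⟩
    have h1 : (⨅ (t : ℕ → Set X) (_ : A ⊆ ⋃ n, t n)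
        (_ : ∀ n, Metric.ediam (t n) ≤ (j + 1 : ℝ≥0∞)⁻¹),
          ∑' n, ⨆ _ : (t n).Nonempty, Metric.ediam (t n) ^ (d + 1)) < M + (j + 1 : ℝ≥0∞)⁻¹ := by
      refine lt_of_le_of_lt ?_ (ENNReal.lt_add_right hA hj.ne')
      rw [hM, Measure.hausdorffMeasure_apply]
      exact le_iSup₂_of_le _ hj le_rfl
    simp only [iInf_lt_iff] at h1
    obtain ⟨t, h1, h2, h3⟩ := h1
    exact ⟨t, h1, h2, h3.le⟩
  choose T hT1 hT2 hT3 using hcover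
  -- Each covering set contributes its diameter to the power `d` on the shadow it casts under `f`.
  -- Taking closures makes the shadows measurable without enlarging their diameters, which bound
  -- their lengths. Fatou's lemma then controls the liminf.
  let G : ℕ → ℝ → ℝ≥0∞ := fun j t => ∑' i, (closure (f '' (A ∩ T j i))).indicator
    (fun _ => Metric.ediam (T j i) ^ d) t
  have hGm : ∀ j, Measurable (G j) := fun j =>
    Measurable.tsum fun i => measurable_const.indicator isClosed_closure.measurableSet
  refine ⟨fun t => liminf (fun j => G j t) atTop, Measurable.liminf hGm, fun t => ?_, ?_⟩
  · refine (Measure.hausdorffMeasure_le_liminf_tsum (β := ℕ)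
      (ι := fun j => {i : ℕ | t ∈ f '' (A ∩ T j i)}) d (A ∩ {x | f x = t}) (l := atTop)
      (fun j => (j + 1 : ℝ≥0∞)⁻¹) ?_ (fun j i => T j i) ?_ ?_).trans ?_
    · have := (tendsto_add_atTop_iff_nat 1).2 ENNReal.tendsto_inv_nat_nhds_zero
      simpa using this
    · exact Eventually.of_forall fun j i => hT2 j i
    · refine Eventually.of_forall fun j x hx => ?_
      obtain ⟨i, hi⟩ := mem_iUnion.1 (hT1 j hx.1)
      exact mem_iUnion.2 ⟨⟨i, x, ⟨hx.1, hi⟩, hx.2⟩, hi⟩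
    · refine liminf_le_liminf (Eventually.of_forall fun j => ?_)
      rw [tsum_subtype {i : ℕ | t ∈ f '' (A ∩ T j i)} fun i => Metric.ediam (T j i) ^ d]
      refine ENNReal.tsum_le_tsum fun i => ?_
      by_cases h : t ∈ f '' (A ∩ T j i)
      · rw [indicator_of_mem (by exact h), indicator_of_mem (subset_closure h)]
      · rw [indicator_of_notMem (by exact h)]; exact zero_le
  · refine (lintegral_liminf_le hGm).trans ?_
    have hb : ∀ j, ∫⁻ t, G j t ≤ K * (M + (j + 1 : ℝ≥0∞)⁻¹) := by
      intro j
      refine le_trans ?_ (mul_le_mul_right (hT3 j) _)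
      rw [lintegral_tsum fun i =>
        (measurable_const.indicator isClosed_closure.measurableSet).aemeasurable,
        ← ENNReal.tsum_mul_left]
      refine ENNReal.tsum_le_tsum fun i => ?_
      rw [lintegral_indicator isClosed_closure.measurableSet, setLIntegral_const]
      rcases (A ∩ T j i).eq_empty_or_nonempty with h | h
      · simp [h]
      · rw [iSup_pos (h.mono inter_subset_right), ENNReal.rpow_add_of_nonneg _ _ hd zero_le_one,
          ENNReal.rpow_one, mul_left_comm]
        refine mul_le_mul_right ?_ _
        refine (Real.volume_le_diam _).trans ?_
        rw [Metric.ediam_closure]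
        exact (by simpa using (hf.mono inter_subset_left).holderOnWith.ediam_image_le :
          Metric.ediam (f '' (A ∩ T j i)) ≤ K * Metric.ediam (A ∩ T j i)).trans
          (mul_le_mul_right (Metric.ediam_mono inter_subset_right) _)
    have hlim : Tendsto (fun j : ℕ => (K : ℝ≥0∞) * (M + (j + 1 : ℝ≥0∞)⁻¹)) atTop (𝓝 (K * (M + 0))) := by
      refine ENNReal.Tendsto.const_mul (tendsto_const_nhds.add ?_) (Or.inr ENNReal.coe_ne_top)
      have := (tendsto_add_atTop_iff_nat 1).2 ENNReal.tendsto_inv_nat_nhds_zero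
      simpa using this
    rw [add_zero] at hlim
    calc liminf (fun j => ∫⁻ t, G j t) atTop
        ≤ liminf (fun j : ℕ => (K : ℝ≥0∞) * (M + (j + 1 : ℝ≥0∞)⁻¹)) atTop :=
          liminf_le_liminf (Eventually.of_forall hb)
      _ = K * M := hlim.liminf_eq


/-! ### Slices by parallel hyperplanes -/

theorem isometry_cons {m : ℕ} (s : ℝ) :
    Isometry (fun z : Space m => (WithLp.toLp 2 (Fin.cons s z.ofLp) : Space (m + 1))) := by
  refine Isometry.of_dist_eq fun x y => ?_
  simp [EuclideanSpace.dist_eq, Fin.sum_univ_succ]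

/-- Each slice is an isometric copy of a section of `M` in `ℝᵐ`, where the Hausdorff measure is `c`
times Lebesgue measure; the claim is then Tonelli's theorem. -/
theorem measurable_and_lintegral_hausdorffMeasure_slice_coord {m : ℕ} {c : ℝ≥0}
    (hc : (Measure.hausdorffMeasure (m : ℝ) : Measure (Space m)) = c • volume)
    {M : Set (Space (m + 1))} (hM : MeasurableSet M) :
    Measurable (fun s : ℝ => Measure.hausdorffMeasure (m : ℝ) (M ∩ {x | x 0 = s})) ∧
      ∫⁻ s : ℝ, Measure.hausdorffMeasure (m : ℝ) (M ∩ {x | x 0 = s}) = c * volume M := by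
  let e₁ := (MeasurableEquiv.toLp 2 (Fin (m + 1) → ℝ)).symm
  let e₂ := MeasurableEquiv.piFinSuccAbove (fun _ : Fin (m + 1) => ℝ) 0
  let e₃ := (MeasurableEquiv.toLp 2 (Fin m → ℝ))
  have h₁ : MeasurePreserving e₁ volume volume :=
    EuclideanSpace.volume_preserving_symm_measurableEquiv_toLp _
  have h₂ : MeasurePreserving e₂ volume volume := volume_preserving_piFinSuccAbove _ 0
  have h₃ : MeasurePreserving e₃ volume volume :=
    (EuclideanSpace.volume_preserving_symm_measurableEquiv_toLp (Fin m)).symm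
  have h₄ : MeasurePreserving (Prod.map id e₃ : ℝ × (Fin m → ℝ) → ℝ × Space m)
      (volume.prod volume) (volume.prod volume) := (MeasurePreserving.id volume).prod h₃
  let e : Space (m + 1) ≃ᵐ ℝ × Space m :=
    (e₁.trans e₂).trans ((MeasurableEquiv.refl ℝ).prodCongr e₃)
  have he : MeasurePreserving e volume (volume.prod volume) := h₄.comp (h₂.comp h₁)
  have key : ∀ s : ℝ, Measure.hausdorffMeasure (m : ℝ) (M ∩ {x | x 0 = s}) =
      c * volume (Prod.mk s ⁻¹' (e.symm ⁻¹' M)) := by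
    intro s
    have h5 : M ∩ {x | x 0 = s} = (fun z : Space m =>
        (WithLp.toLp 2 (Fin.cons s z.ofLp) : Space (m + 1))) '' (Prod.mk s ⁻¹' (e.symm ⁻¹' M)) := by
      have hsymm : ∀ z : Space m, e.symm (s, z) = WithLp.toLp 2 (Fin.cons s z.ofLp) := by
        intro z
        rw [MeasurableEquiv.symm_apply_eq]
        ext <;> simp [e, e₁, e₂, e₃, MeasurableEquiv.prodCongr, MeasurableEquiv.piFinSuccAbove]
      ext x
      constructor
      · rintro ⟨hx, rfl⟩
        have hx' : (WithLp.toLp 2 (Fin.cons (x 0) (Fin.tail x.ofLp)) : Space (m + 1)) = x := by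
          ext i; simp [Fin.cons_self_tail]
        refine ⟨WithLp.toLp 2 (Fin.tail x.ofLp), ?_, hx'⟩
        simpa [hsymm, hx'] using hx
      · rintro ⟨z, hz, rfl⟩
        exact ⟨by simpa [hsymm] using hz, by simp⟩
    rw [h5, (isometry_cons s).hausdorffMeasure_image (Or.inl (Nat.cast_nonneg m)), hc]
    rfl
  have hM' : MeasurableSet (e.symm ⁻¹' M) := e.symm.measurable hM
  simp_rw [key]
  refine ⟨(measurable_measure_prodMk_left hM').const_mul _, ?_⟩
  rw [lintegral_const_mul _ (measurable_measure_prodMk_left hM'), ← Measure.prod_apply hM',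
    ← he.measure_preimage hM'.nullMeasurableSet]
  congr 2
  ext x; simp

/-- Fubini's theorem for the slices of a set by parallel hyperplanes. -/
theorem exists_lintegral_hausdorffMeasure_slice (m : ℕ) : ∃ c : ℝ≥0, c ≠ 0 ∧
    ∀ e : Space (m + 1), ‖e‖ = 1 → ∀ M : Set (Space (m + 1)), MeasurableSet M →
      Measurable (fun s : ℝ => Measure.hausdorffMeasure (m : ℝ) (M ∩ {x | inner ℝ e x = s})) ∧
      ∫⁻ s : ℝ, Measure.hausdorffMeasure (m : ℝ) (M ∩ {x | inner ℝ e x = s}) = c * volume M := by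
  refine ⟨_, (Measure.addHaarScalarFactor_pos_of_isAddHaarMeasure
    (Measure.hausdorffMeasure (m : ℝ) : Measure (Space m)) volume).ne', fun e he M hM => ?_⟩
  -- Rotate so that `e` becomes the first basis vector; Hausdorff and Lebesgue measure are both
  -- invariant.
  obtain ⟨b, hb⟩ := Orthonormal.exists_orthonormalBasis_extension_of_card_eq (𝕜 := ℝ)
    (E := Space (m + 1)) (ι := Fin (m + 1)) (by simp) (v := fun _ => e) (s := {0})
    ⟨fun _ => he, fun i j hij => (hij (Subsingleton.elim i j)).elim⟩
  have hb0 : b 0 = e := hb 0 rfl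
  have h0 : ∀ s : ℝ, Measure.hausdorffMeasure (m : ℝ) (M ∩ {x | inner ℝ e x = s}) =
      Measure.hausdorffMeasure (m : ℝ) (b.repr.symm ⁻¹' M ∩ {x | x 0 = s}) := by
    intro s
    rw [← b.repr.symm.isometry.hausdorffMeasure_image (Or.inl (Nat.cast_nonneg m))
      (b.repr.symm ⁻¹' M ∩ {x | x 0 = s})]
    congr 1
    ext x
    constructor
    · rintro ⟨hx, hs⟩
      exact ⟨b.repr x, ⟨by simpa using hx, by simpa [hb0, b.repr_apply_apply] using hs⟩, by simp⟩
    · rintro ⟨y, ⟨hy, hs⟩, rfl⟩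
      refine ⟨hy, ?_⟩
      have := b.repr_apply_apply (b.repr.symm y) 0
      simp only [LinearIsometryEquiv.apply_symm_apply, hb0] at this
      simpa [← this] using hs
  simp_rw [h0]
  have := measurable_and_lintegral_hausdorffMeasure_slice_coord
    (Measure.isAddLeftInvariant_eq_smul _ _) (b.repr.symm.continuous.measurable hM)
  refine ⟨this.1, this.2.trans ?_⟩
  rw [b.repr.symm.measurePreserving.measure_preimage hM.nullMeasurableSet]


/-! ### The coarea formula on regular points -/

/-- The hypothesis forces `f` to be injective on `T` with an `L`-Lipschitz inverse on the image; `f`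
itself need not be continuous. -/
theorem hausdorffMeasure_le_of_edist_le {X Y : Type*} [EMetricSpace X] [EMetricSpace Y]
    [MeasurableSpace X] [BorelSpace X] [MeasurableSpace Y] [BorelSpace Y] {f : X → Y} {T : Set X}
    {L : ℝ≥0} (h : ∀ x ∈ T, ∀ y ∈ T, edist x y ≤ L * edist (f x) (f y)) {d : ℝ} (hd : 0 ≤ d) :
    Measure.hausdorffMeasure d T ≤ (L : ℝ≥0∞) ^ d * Measure.hausdorffMeasure d (f '' T) := by
  rcases T.eq_empty_or_nonempty with rfl | ⟨x₀, -⟩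
  · simp
  have : Nonempty X := ⟨x₀⟩
  have hinj : InjOn f T := fun x hx y hy hxy => by
    have := h x hx y hy
    rw [hxy, edist_self, mul_zero] at this
    exact edist_le_zero.1 this
  have hinv : LeftInvOn (Function.invFunOn f T) f T := hinj.leftInvOn_invFunOn
  have hL : LipschitzOnWith L (Function.invFunOn f T) (f '' T) := by
    rintro _ ⟨x, hx, rfl⟩ _ ⟨y, hy, rfl⟩
    rw [hinv hx, hinv hy]
    exact h x hx y hy
  have := hL.hausdorffMeasure_image_le hd
  rwa [hinv.image_image] at this

theorem ofReal_le_coe_mul_ofReal {a b : ℝ} {L : ℝ≥0} (h : a ≤ L * b) :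
    ENNReal.ofReal a ≤ L * ENNReal.ofReal b := by
  rw [← ENNReal.ofReal_coe_nnreal, ← ENNReal.ofReal_mul L.coe_nonneg]
  exact ENNReal.ofReal_le_ofReal h

theorem exists_volume_eq_smul_hausdorffMeasure (m : ℕ) : ∃ c : ℝ≥0,
    (volume : Measure (Space m)) = c • Measure.hausdorffMeasure (m : ℝ) :=
  ⟨_, Measure.isAddLeftInvariant_eq_smul _ _⟩

theorem volume_image_le_of_lipschitzOnWith {m : ℕ} {f : Space m → Space m} {T : Set (Space m)}
    {L : ℝ≥0} (h : LipschitzOnWith L f T) : volume (f '' T) ≤ (L : ℝ≥0∞) ^ m * volume T := by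
  obtain ⟨c, hc⟩ := exists_volume_eq_smul_hausdorffMeasure m
  rw [hc, Measure.smul_apply, Measure.smul_apply, mul_smul_comm]
  have := h.hausdorffMeasure_image_le (d := m) (Nat.cast_nonneg m)
  rw [ENNReal.rpow_natCast] at this
  gcongr

theorem volume_le_of_edist_le {m : ℕ} {f : Space m → Space m} {T : Set (Space m)}
    {L : ℝ≥0} (h : ∀ x ∈ T, ∀ y ∈ T, edist x y ≤ L * edist (f x) (f y)) :
    volume T ≤ (L : ℝ≥0∞) ^ m * volume (f '' T) := by
  obtain ⟨c, hc⟩ := exists_volume_eq_smul_hausdorffMeasure m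
  rw [hc, Measure.smul_apply, Measure.smul_apply, mul_smul_comm]
  have := hausdorffMeasure_le_of_edist_le h (d := m) (Nat.cast_nonneg m)
  rw [ENNReal.rpow_natCast] at this
  gcongr

/-- The corresponding bound for maps of the space to itself is applied to `x ↦ u x • e` with `e` a
unit vector, which leaves operator norms unchanged. -/
theorem ae_norm_fderiv_sub_le {m : ℕ} {u : Space (m + 1) → ℝ} {A : Space (m + 1) →L[ℝ] ℝ}
    {S : Set (Space (m + 1))} {δ : ℝ≥0} (h : ApproximatesLinearOn u A S δ) (hS : MeasurableSet S)
    (hu : ∀ x ∈ S, DifferentiableAt ℝ u x) :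
    ∀ᵐ x ∂(volume.restrict S), ‖fderiv ℝ u x - A‖ ≤ δ := by
  let e : Space (m + 1) := EuclideanSpace.single 0 1
  have he : ‖e‖ = 1 := by simp [e]
  have h' : ApproximatesLinearOn (fun x => u x • e) (A.smulRight e) S δ := by
    intro x hx y hy
    have : u x • e - u y • e - (A.smulRight e) (x - y) = (u x - u y - A (x - y)) • e := by
      simp [sub_smul]
    rw [this, norm_smul, he, mul_one]
    exact h x hx y hy
  have h2 := h'.norm_fderiv_sub_le volume hS (fun x => (fderiv ℝ u x).smulRight e)
    fun x hx => ((hu x hx).hasFDerivAt.smul_const e).hasFDerivWithinAt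
  filter_upwards [h2] with x hx
  have h3 : (fderiv ℝ u x).smulRight e - A.smulRight e = (fderiv ℝ u x - A).smulRight e := by
    ext v; simp [sub_mul]
  rw [h3] at hx
  have hx' : ‖(fderiv ℝ u x - A).smulRight e‖ ≤ δ := hx
  rwa [ContinuousLinearMap.norm_smulRight_apply, he, mul_one] at hx'

/-- The constant `c` is the one of Fubini's theorem for hyperplane slices in dimension `m + 1`. -/
def IsSliceConstant (m : ℕ) (c : ℝ≥0) : Prop :=
  ∀ e : Space (m + 1), ‖e‖ = 1 → ∀ M : Set (Space (m + 1)), MeasurableSet M →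
    Measurable (fun s : ℝ => Measure.hausdorffMeasure (m : ℝ) (M ∩ {x | inner ℝ e x = s})) ∧
    ∫⁻ s : ℝ, Measure.hausdorffMeasure (m : ℝ) (M ∩ {x | inner ℝ e x = s}) = c * volume M

/-- The coarea formula up to the factor `L`. -/
def HasApproxCoarea {m : ℕ} (c : ℝ≥0) (u : Space (m + 1) → ℝ) (S : Set (Space (m + 1)))
    (L : ℝ≥0) : Prop :=
  ∃ g : ℝ → ℝ≥0∞, Measurable g ∧
    (∀ t, g t ≤ (L : ℝ≥0∞) ^ m * Measure.hausdorffMeasure (m : ℝ) (S ∩ {x | u x = t})) ∧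
    (∀ t, Measure.hausdorffMeasure (m : ℝ) (S ∩ {x | u x = t}) ≤ (L : ℝ≥0∞) ^ m * g t) ∧
    ∫⁻ t, g t ≤ (L : ℝ≥0∞) ^ (m + 2) * (c * ∫⁻ x in S, ‖fderiv ℝ u x‖ₑ) ∧
    c * ∫⁻ x in S, ‖fderiv ℝ u x‖ₑ ≤ (L : ℝ≥0∞) ^ (m + 2) * ∫⁻ t, g t

theorem lintegral_comp_mul_left_of_pos {h : ℝ → ℝ≥0∞} (hh : Measurable h) {a : ℝ} (ha : 0 < a) :
    ∫⁻ t, h (a⁻¹ * t) = ENNReal.ofReal a * ∫⁻ t, h t := by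
  rw [← lintegral_map (μ := volume) hh (measurable_const_mul a⁻¹),
    Real.map_volume_mul_left (inv_ne_zero ha.ne'), lintegral_smul_measure, inv_inv,
    abs_of_pos ha, smul_eq_mul]

/-- With `e` the unit vector along `A`, the map `Φ = id + ‖A‖⁻¹(u - A)e` straightens the level sets:
`⟨e, Φ⟩ = ‖A‖⁻¹u`, so `{u = t}` goes into a hyperplane. Near-linearity makes `Φ` bi-Lipschitz with
constant `L`, and Fubini's theorem for the hyperplane slices of `Φ(S)` is pulled back at the cost of
powers of `L`. -/
theorem ApproximatesLinearOn.hasApproxCoarea {m : ℕ} {c : ℝ≥0} (hc : IsSliceConstant m c)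
    {u : Space (m + 1) → ℝ} {A : Space (m + 1) →L[ℝ] ℝ} (hA : A ≠ 0) {L : ℝ≥0} (hL : 1 < L)
    {S : Set (Space (m + 1))} (hS : MeasurableSet S)
    (happ : ApproximatesLinearOn u A S ((1 - L⁻¹) * ‖A‖₊))
    (hu : ∀ x ∈ S, DifferentiableAt ℝ u x) : HasApproxCoarea c u S L := by
  set l : ℝ := ‖A‖ with hl
  have hl0 : 0 < l := norm_pos_iff.2 hA
  have hLr : (1 : ℝ) < L := hL
  have hL0 : (0 : ℝ) < L := zero_lt_one.trans hLr
  have hLi : L⁻¹ ≤ 1 := inv_le_one_of_one_le₀ hL.le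
  have hδ : (((1 - L⁻¹) * ‖A‖₊ : ℝ≥0) : ℝ) = (1 - (L : ℝ)⁻¹) * l := by
    rw [NNReal.coe_mul, NNReal.coe_sub hLi]; simp [hl]
  -- The relative error `1 - 1/L` distorts lengths by factors between `1 - (1 - 1/L) = 1/L` and `1 +
  -- (1 - 1/L)`; this inequality puts the latter below `L`.
  have h2L : 2 - (L : ℝ)⁻¹ ≤ L := by
    have h : (L : ℝ) - (2 - (L : ℝ)⁻¹) = (L - 1) ^ 2 * (L : ℝ)⁻¹ := by field_simp; ring
    have : 0 ≤ ((L : ℝ) - 1) ^ 2 * (L : ℝ)⁻¹ := by positivity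
    linarith
  let e : Space (m + 1) := l⁻¹ • (InnerProductSpace.toDual ℝ (Space (m + 1))).symm A
  have he : ‖e‖ = 1 := by
    simp only [e, norm_smul, LinearIsometryEquiv.norm_map, norm_inv, Real.norm_of_nonneg hl0.le]
    exact inv_mul_cancel₀ hl0.ne'
  have hei : ∀ x, inner ℝ e x = l⁻¹ * A x := fun x => by
    simp [e, real_inner_smul_left]
  let Φ : Space (m + 1) → Space (m + 1) := fun x => x + (l⁻¹ * (u x - A x)) • e
  have hΦe : ∀ x, inner ℝ e (Φ x) = l⁻¹ * u x := fun x => by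
    change inner ℝ e (x + (l⁻¹ * (u x - A x)) • e) = _
    rw [inner_add_right, real_inner_smul_right, real_inner_self_eq_norm_sq, he, hei]
    ring
  have hΦ : ∀ x ∈ S, ∀ y ∈ S, ‖(Φ x - Φ y) - (x - y)‖ ≤ (1 - (L : ℝ)⁻¹) * ‖x - y‖ := by
    intro x hx y hy
    have h1 : (Φ x - Φ y) - (x - y) = (l⁻¹ * (u x - u y - A (x - y))) • e := by
      simp only [Φ, map_sub]
      module
    have h2 := happ x hx y hy
    rw [hδ] at h2
    rw [h1, norm_smul, he, mul_one, norm_mul, norm_inv, Real.norm_of_nonneg hl0.le,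
      inv_mul_le_iff₀ hl0]
    linarith
  have hlip : LipschitzOnWith L Φ S := LipschitzOnWith.of_dist_le_mul fun x hx y hy => by
    rw [dist_eq_norm, dist_eq_norm]
    have := hΦ x hx y hy
    have h3 : ‖Φ x - Φ y‖ ≤ ‖(Φ x - Φ y) - (x - y)‖ + ‖x - y‖ := norm_le_norm_sub_add _ _
    nlinarith [norm_nonneg (x - y)]
  have hanti : ∀ x ∈ S, ∀ y ∈ S, edist x y ≤ L * edist (Φ x) (Φ y) := fun x hx y hy => by
    have h1 : dist x y ≤ L * dist (Φ x) (Φ y) := by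
      rw [dist_eq_norm, dist_eq_norm]
      have := hΦ x hx y hy
      have h3 : ‖x - y‖ - ‖Φ x - Φ y‖ ≤ ‖(Φ x - Φ y) - (x - y)‖ := by
        rw [norm_sub_rev (Φ x - Φ y)]; exact norm_sub_norm_le _ _
      have h4 : (L : ℝ)⁻¹ * ‖x - y‖ ≤ ‖Φ x - Φ y‖ := by linarith
      rwa [inv_mul_le_iff₀ hL0] at h4
    rw [edist_dist, edist_dist]
    exact ofReal_le_coe_mul_ofReal h1
  have hinj : InjOn Φ S := fun x hx y hy hxy => by
    have := hanti x hx y hy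
    rw [hxy, edist_self, mul_zero] at this
    exact edist_le_zero.1 this
  have hΦS : MeasurableSet (Φ '' S) := hS.image_of_continuousOn_injOn hlip.continuousOn hinj
  obtain ⟨hm, hint⟩ := hc e he (Φ '' S) hΦS
  have himage : ∀ t, Φ '' S ∩ {x | inner ℝ e x = l⁻¹ * t} = Φ '' (S ∩ {x | u x = t}) := by
    intro t
    ext y
    constructor
    · rintro ⟨⟨x, hx, rfl⟩, hy⟩
      refine ⟨x, ⟨hx, ?_⟩, rfl⟩
      have hy' : inner ℝ e (Φ x) = l⁻¹ * t := hy
      rw [hΦe] at hy'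
      exact mul_left_cancel₀ (inv_ne_zero hl0.ne') hy'
    · rintro ⟨x, ⟨hx, hxt⟩, rfl⟩
      exact ⟨⟨x, hx, rfl⟩, by rw [mem_ofPred_eq, hΦe, show u x = t from hxt]⟩
  have hgint : ∫⁻ t, Measure.hausdorffMeasure (m : ℝ) (Φ '' S ∩ {x | inner ℝ e x = l⁻¹ * t}) =
      ENNReal.ofReal l * (c * volume (Φ '' S)) := by
    rw [lintegral_comp_mul_left_of_pos hm hl0, hint]
  have hfd := ae_norm_fderiv_sub_le happ hS hu
  rw [hδ] at hfd
  have hup : ∫⁻ x in S, ‖fderiv ℝ u x‖ₑ ≤ L * (ENNReal.ofReal l * volume S) := by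
    rw [← setLIntegral_const, ← lintegral_const_mul' _ _ ENNReal.coe_ne_top]
    refine lintegral_mono_ae (hfd.mono fun x hx => ?_)
    rw [← ofReal_norm]
    refine ofReal_le_coe_mul_ofReal ?_
    have : ‖fderiv ℝ u x‖ ≤ ‖fderiv ℝ u x - A‖ + ‖A‖ := norm_le_norm_sub_add _ _
    nlinarith
  have hlow : ENNReal.ofReal l * volume S ≤ L * ∫⁻ x in S, ‖fderiv ℝ u x‖ₑ := by
    rw [← setLIntegral_const, ← lintegral_const_mul' _ _ ENNReal.coe_ne_top]
    refine lintegral_mono_ae (hfd.mono fun x hx => ?_)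
    rw [← ofReal_norm]
    refine ofReal_le_coe_mul_ofReal ?_
    have h3 : ‖A‖ - ‖fderiv ℝ u x‖ ≤ ‖fderiv ℝ u x - A‖ := by
      rw [norm_sub_rev]; exact norm_sub_norm_le _ _
    have h4 : (L : ℝ)⁻¹ * l ≤ ‖fderiv ℝ u x‖ := by linarith
    rwa [inv_mul_le_iff₀ hL0] at h4
  have hv1 : volume (Φ '' S) ≤ (L : ℝ≥0∞) ^ (m + 1) * volume S :=
    volume_image_le_of_lipschitzOnWith hlip
  have hv2 : volume S ≤ (L : ℝ≥0∞) ^ (m + 1) * volume (Φ '' S) := volume_le_of_edist_le hanti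
  -- In the exponent `m + 2`, the volume distortion of `Φ` accounts for `m + 1` and the comparison
  -- of `‖fderiv ℝ u x‖` with `‖A‖` for one more.
  refine ⟨fun t => Measure.hausdorffMeasure (m : ℝ) (Φ '' S ∩ {x | inner ℝ e x = l⁻¹ * t}),
    hm.comp (measurable_const_mul _), fun t => ?_, fun t => ?_, ?_, ?_⟩
  · beta_reduce
    rw [himage, ← ENNReal.rpow_natCast]
    exact (hlip.mono inter_subset_left).hausdorffMeasure_image_le (Nat.cast_nonneg m)
  · beta_reduce
    rw [himage, ← ENNReal.rpow_natCast]
    exact hausdorffMeasure_le_of_edist_le (fun x hx y hy => hanti x hx.1 y hy.1)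
      (Nat.cast_nonneg m)
  · rw [hgint]
    calc ENNReal.ofReal l * (c * volume (Φ '' S))
        ≤ ENNReal.ofReal l * (c * ((L : ℝ≥0∞) ^ (m + 1) * volume S)) := by gcongr
      _ = (L : ℝ≥0∞) ^ (m + 1) * (c * (ENNReal.ofReal l * volume S)) := by ring
      _ ≤ (L : ℝ≥0∞) ^ (m + 1) * (c * (L * ∫⁻ x in S, ‖fderiv ℝ u x‖ₑ)) := by gcongr
      _ = _ := by ring
  · rw [hgint]
    calc c * ∫⁻ x in S, ‖fderiv ℝ u x‖ₑ ≤ c * (L * (ENNReal.ofReal l * volume S)) := by gcongr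
      _ ≤ c * (L * (ENNReal.ofReal l * ((L : ℝ≥0∞) ^ (m + 1) * volume (Φ '' S)))) := by gcongr
      _ = _ := by ring

/-- The set of points at which `u` is differentiable with nonzero derivative. -/
def regularPoints {n : ℕ} (u : Space n → ℝ) : Set (Space n) :=
  {x | DifferentiableAt ℝ u x ∧ fderiv ℝ u x ≠ 0}

theorem measurableSet_regularPoints {n : ℕ} (u : Space n → ℝ) :
    MeasurableSet (regularPoints u) :=
  (measurableSet_of_differentiableAt ℝ u).inter
    (measurable_fderiv ℝ u (measurableSet_singleton 0).compl)

theorem hasApproxCoarea_of_subset_regularPoints {m : ℕ} {c : ℝ≥0} (hc : IsSliceConstant m c)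
    {u : Space (m + 1) → ℝ} (hcont : Continuous u) {L : ℝ≥0} (hL : 1 < L)
    {S : Set (Space (m + 1))} (hS : MeasurableSet S) (hSr : S ⊆ regularPoints u) :
    HasApproxCoarea c u S L := by
  rcases S.eq_empty_or_nonempty with rfl | hne
  · exact ⟨0, measurable_const, by simp, by simp, by simp, by simp⟩
  have hLi : 0 < 1 - L⁻¹ := tsub_pos_of_lt (inv_lt_one_of_one_lt₀ hL)
  classical
  obtain ⟨T, A, hTd, hTm, hST, happ, hA⟩ :=
    exists_partition_approximatesLinearOn_of_hasFDerivWithinAt u S (fderiv ℝ u)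
      (fun x hx => (hSr hx).1.hasFDerivAt.hasFDerivWithinAt)
      (fun A => if A = 0 then 1 else (1 - L⁻¹) * ‖A‖₊) (fun A => by
        split_ifs with h
        · exact one_ne_zero
        · exact mul_ne_zero hLi.ne' (nnnorm_ne_zero_iff.2 h))
  have hA0 : ∀ i, A i ≠ 0 := fun i => by
    obtain ⟨y, hy, hyA⟩ := hA hne i
    rw [hyA]; exact (hSr hy).2
  have hpiece : ∀ i, HasApproxCoarea c u (S ∩ T i) L := fun i =>
    ApproximatesLinearOn.hasApproxCoarea hc (hA0 i) hL (hS.inter (hTm i))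
      (by simpa [hA0 i] using happ i) fun x hx => (hSr hx.1).1
  choose g hgm hg1 hg2 hg3 hg4 using hpiece
  have hU : S = ⋃ i, S ∩ T i := by rw [← inter_iUnion, inter_eq_left.2 hST]
  have hdisj : Pairwise (Function.onFun Disjoint fun i => S ∩ T i) := fun i j hij =>
    (hTd hij).mono inter_subset_right inter_subset_right
  have hslice : ∀ t, Measure.hausdorffMeasure (m : ℝ) (S ∩ {x | u x = t}) =
      ∑' i, Measure.hausdorffMeasure (m : ℝ) ((S ∩ T i) ∩ {x | u x = t}) := by
    intro t
    rw [← measure_iUnion, ← iUnion_inter, ← hU]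
    · exact fun i j hij => (hdisj hij).mono inter_subset_left inter_subset_left
    · exact fun i => (hS.inter (hTm i)).inter (isClosed_eq hcont continuous_const).measurableSet
  have hint : ∫⁻ x in S, ‖fderiv ℝ u x‖ₑ = ∑' i, ∫⁻ x in S ∩ T i, ‖fderiv ℝ u x‖ₑ := by
    conv_lhs => rw [hU]
    exact lintegral_iUnion (fun i => hS.inter (hTm i)) hdisj _
  refine ⟨fun t => ∑' i, g i t, Measurable.tsum hgm, fun t => ?_, fun t => ?_, ?_, ?_⟩
  · rw [hslice, ← ENNReal.tsum_mul_left]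
    exact ENNReal.tsum_le_tsum fun i => hg1 i t
  · rw [hslice, ← ENNReal.tsum_mul_left]
    exact ENNReal.tsum_le_tsum fun i => hg2 i t
  · rw [lintegral_tsum fun i => (hgm i).aemeasurable, hint, ← ENNReal.tsum_mul_left,
      ← ENNReal.tsum_mul_left]
    exact ENNReal.tsum_le_tsum hg3
  · rw [lintegral_tsum fun i => (hgm i).aemeasurable, hint, ← ENNReal.tsum_mul_left,
      ← ENNReal.tsum_mul_left]
    exact ENNReal.tsum_le_tsum hg4

/-- Let `L → 1`. The measurable functions `g k` are squeezed onto the slice measure, which gives its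
measurability, and the two integral inequalities close up to an equality. -/
theorem coarea_of_subset_regularPoints {m : ℕ} {c : ℝ≥0} (hc : IsSliceConstant m c)
    {u : Space (m + 1) → ℝ} (hcont : Continuous u)
    {S : Set (Space (m + 1))} (hS : MeasurableSet S) (hSr : S ⊆ regularPoints u) :
    Measurable (fun t => Measure.hausdorffMeasure (m : ℝ) (S ∩ {x | u x = t})) ∧
      ∫⁻ t, Measure.hausdorffMeasure (m : ℝ) (S ∩ {x | u x = t}) =
        c * ∫⁻ x in S, ‖fderiv ℝ u x‖ₑ := by
  let L : ℕ → ℝ≥0 := fun k => 1 + ((k : ℝ≥0) + 1)⁻¹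
  have hL : ∀ k, 1 < L k := fun k => lt_add_of_pos_right _ (by positivity)
  have hLlim : Tendsto L atTop (𝓝 1) := by
    have h : Tendsto (fun k : ℕ => ((k : ℝ≥0) + 1)⁻¹) atTop (𝓝 0) := by
      simpa using tendsto_one_div_add_atTop_nhds_zero_nat (𝕜 := ℝ≥0)
    simpa using h.const_add 1
  have hpow : ∀ j : ℕ, Tendsto (fun k => (L k : ℝ≥0∞) ^ j) atTop (𝓝 1) := fun j => by
    have := ENNReal.tendsto_coe.2 (hLlim.pow j)
    simpa using this
  have hL0 : ∀ k j, (L k : ℝ≥0∞) ^ j ≠ 0 := fun k j => by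
    have := (zero_lt_one.trans (hL k)).ne'
    simpa using fun h => absurd h this
  have hLt : ∀ k j, (L k : ℝ≥0∞) ^ j ≠ ⊤ := fun k j => ENNReal.pow_ne_top ENNReal.coe_ne_top
  choose g hgm hg1 hg2 hg3 hg4 using
    fun k => hasApproxCoarea_of_subset_regularPoints hc hcont (hL k) hS hSr
  have hlim : ∀ t, Tendsto (fun k => g k t) atTop
      (𝓝 (Measure.hausdorffMeasure (m : ℝ) (S ∩ {x | u x = t}))) := by
    intro t
    set ρ := Measure.hausdorffMeasure (m : ℝ) (S ∩ {x | u x = t})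
    refine tendsto_of_tendsto_of_tendsto_of_le_of_le
      (g := fun k => ((L k : ℝ≥0∞) ^ m)⁻¹ * ρ) (h := fun k => (L k : ℝ≥0∞) ^ m * ρ) ?_ ?_
      (fun k => ?_) (fun k => hg1 k t)
    · have h1 : Tendsto (fun k => ((L k : ℝ≥0∞) ^ m)⁻¹) atTop (𝓝 1) := by
        simpa using ENNReal.tendsto_inv_iff.2 (hpow m)
      simpa using ENNReal.Tendsto.mul_const (b := ρ) h1 (Or.inl one_ne_zero)
    · simpa using ENNReal.Tendsto.mul_const (b := ρ) (hpow m) (Or.inl one_ne_zero)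
    · rw [ENNReal.inv_mul_le_iff (hL0 k m) (hLt k m)]
      exact hg2 k t
  have hmeas := ENNReal.measurable_of_tendsto hgm (tendsto_pi_nhds.2 hlim)
  refine ⟨hmeas, ?_⟩
  set I := ∫⁻ t, Measure.hausdorffMeasure (m : ℝ) (S ∩ {x | u x = t})
  set J := c * ∫⁻ x in S, ‖fderiv ℝ u x‖ₑ
  have hmul : ∀ (a : ℝ≥0∞) (j : ℕ), Tendsto (fun k => (L k : ℝ≥0∞) ^ j * a) atTop (𝓝 a) :=
    fun a j => by simpa using ENNReal.Tendsto.mul_const (b := a) (hpow j) (Or.inl one_ne_zero)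
  refine le_antisymm (ge_of_tendsto' (hmul J (m + (m + 2))) fun k => ?_)
    (ge_of_tendsto' (hmul I (m + 2 + m)) fun k => ?_)
  · calc I ≤ ∫⁻ t, (L k : ℝ≥0∞) ^ m * g k t := lintegral_mono (hg2 k)
      _ = (L k : ℝ≥0∞) ^ m * ∫⁻ t, g k t := lintegral_const_mul _ (hgm k)
      _ ≤ (L k : ℝ≥0∞) ^ m * ((L k : ℝ≥0∞) ^ (m + 2) * J) := by gcongr; exact hg3 k
      _ = _ := by rw [pow_add _ m (m + 2), mul_assoc]
  · calc J ≤ (L k : ℝ≥0∞) ^ (m + 2) * ∫⁻ t, g k t := hg4 k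
      _ ≤ (L k : ℝ≥0∞) ^ (m + 2) *
          ∫⁻ t, (L k : ℝ≥0∞) ^ m * Measure.hausdorffMeasure (m : ℝ) (S ∩ {x | u x = t}) := by
        gcongr; exact hg1 k _
      _ = _ := by rw [lintegral_const_mul _ hmeas, pow_add _ (m + 2) m, mul_assoc]


/-! ### Negligible parts of level sets -/

theorem exists_hausdorffMeasure_eq_smul_volume (m : ℕ) : ∃ c : ℝ≥0,
    (Measure.hausdorffMeasure ((m : ℝ) + 1) : Measure (Space (m + 1))) = c • volume := by
  rw [← Nat.cast_succ]
  exact ⟨_, Measure.isAddLeftInvariant_eq_smul _ _⟩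

theorem hausdorffMeasure_ne_top_of_isBounded {m : ℕ} {S : Set (Space (m + 1))}
    (hS : Bornology.IsBounded S) : Measure.hausdorffMeasure ((m : ℝ) + 1) S ≠ ⊤ := by
  obtain ⟨c, h⟩ := exists_hausdorffMeasure_eq_smul_volume m
  rw [h, Measure.smul_apply]
  exact ENNReal.mul_ne_top ENNReal.coe_ne_top hS.measure_lt_top.ne

theorem hausdorffMeasure_eq_zero_of_volume_eq_zero {m : ℕ} {S : Set (Space (m + 1))}
    (hS : volume S = 0) : Measure.hausdorffMeasure ((m : ℝ) + 1) S = 0 := by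
  obtain ⟨c, h⟩ := exists_hausdorffMeasure_eq_smul_volume m
  rw [h, Measure.smul_apply, hS, smul_zero]

/-- `ρ` may fail to be measurable, but the infimum of countably many majorants is measurable and has
integral zero. -/
theorem ae_eq_zero_of_forall_majorant {ρ : ℝ → ℝ≥0∞} {M : ℝ≥0∞} (hM : M ≠ ⊤)
    (h : ∀ ε : ℝ≥0, 0 < ε → ∃ g : ℝ → ℝ≥0∞, Measurable g ∧ (∀ t, ρ t ≤ g t) ∧
      ∫⁻ t, g t ≤ ε * M) : ∀ᵐ t, ρ t = 0 := by
  choose! g hgm hg hgi using h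
  let ε : ℕ → ℝ≥0 := fun k => ((k : ℝ≥0) + 1)⁻¹
  have hε : ∀ k, 0 < ε k := fun k => by positivity
  have hεlim : Tendsto ε atTop (𝓝 0) := by
    simpa using tendsto_one_div_add_atTop_nhds_zero_nat (𝕜 := ℝ≥0)
  have hG : Measurable fun t => ⨅ k, g (ε k) t := Measurable.iInf fun k => hgm _ (hε k)
  have h0 : ∫⁻ t, ⨅ k, g (ε k) t = 0 := by
    refine le_antisymm ?_ zero_le
    have hlim : Tendsto (fun k => (ε k : ℝ≥0∞) * M) atTop (𝓝 0) := by
      simpa using ENNReal.Tendsto.mul_const (b := M) (ENNReal.tendsto_coe.2 hεlim) (Or.inr hM)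
    exact ge_of_tendsto' hlim fun k => (lintegral_mono fun t => iInf_le _ k).trans (hgi _ (hε k))
  filter_upwards [(lintegral_eq_zero_iff hG).1 h0] with t ht
  exact le_antisymm ((le_iInf fun k => hg _ (hε k) t).trans ht.le) zero_le

theorem ae_hausdorffMeasure_slice_eq_zero_of_volume_eq_zero {m : ℕ} {u : Space (m + 1) → ℝ}
    {S : Set (Space (m + 1))} {K : ℝ≥0} (hu : LipschitzOnWith K u S) (hS : volume S = 0) :
    ∀ᵐ t, Measure.hausdorffMeasure (m : ℝ) (S ∩ {x | u x = t}) = 0 := by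
  have h0 := hausdorffMeasure_eq_zero_of_volume_eq_zero hS
  obtain ⟨g, hgm, hg, hgi⟩ := exists_measurable_majorant_hausdorffMeasure_slice hu
    (Nat.cast_nonneg m) (by rw [h0]; exact ENNReal.zero_ne_top)
  exact ae_eq_zero_of_forall_majorant ENNReal.zero_ne_top fun ε _ =>
    ⟨g, hgm, hg, hgi.trans (by rw [h0]; simp)⟩

/-- A Sard-type statement needing no smoothness: where the derivative vanishes, `S` splits into
countably many pieces on which `u` is `ε`-Lipschitz, and Eilenberg's inequality bounds the
integrated slices by `ε` times the measure of `S`. -/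
theorem ae_hausdorffMeasure_slice_eq_zero_of_fderiv_eq_zero {m : ℕ} {u : Space (m + 1) → ℝ}
    {S : Set (Space (m + 1))} (hS : MeasurableSet S) (hSb : Bornology.IsBounded S)
    (hu : ∀ x ∈ S, HasFDerivAt u (0 : Space (m + 1) →L[ℝ] ℝ) x) :
    ∀ᵐ t, Measure.hausdorffMeasure (m : ℝ) (S ∩ {x | u x = t}) = 0 := by
  refine ae_eq_zero_of_forall_majorant (hausdorffMeasure_ne_top_of_isBounded hSb) fun ε hε => ?_
  rcases S.eq_empty_or_nonempty with rfl | hne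
  · exact ⟨0, measurable_const, by simp, by simp⟩
  obtain ⟨T, A, hTd, hTm, hST, happ, hA⟩ :=
    exists_partition_approximatesLinearOn_of_hasFDerivWithinAt u S
      (fun _ => (0 : Space (m + 1) →L[ℝ] ℝ)) (fun x hx => (hu x hx).hasFDerivWithinAt) (fun _ => ε) fun _ => hε.ne'
  have hlip : ∀ i, LipschitzOnWith ε u (S ∩ T i) := fun i => by
    obtain ⟨-, -, h0⟩ := hA hne i
    refine LipschitzOnWith.of_dist_le_mul fun x hx y hy => ?_
    have := happ i x hx y hy
    rw [h0] at this
    simpa [dist_eq_norm] using this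
  have hpiece := fun i => exists_measurable_majorant_hausdorffMeasure_slice (hlip i)
    (Nat.cast_nonneg m) (hausdorffMeasure_ne_top_of_isBounded (hSb.subset inter_subset_left))
  choose g hgm hg hgi using hpiece
  have hU : S = ⋃ i, S ∩ T i := by rw [← inter_iUnion, inter_eq_left.2 hST]
  refine ⟨fun t => ∑' i, g i t, Measurable.tsum hgm, fun t => ?_, ?_⟩
  · calc Measure.hausdorffMeasure (m : ℝ) (S ∩ {x | u x = t})
        = Measure.hausdorffMeasure (m : ℝ) (⋃ i, S ∩ T i ∩ {x | u x = t}) := by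
          rw [← iUnion_inter, ← hU]
      _ ≤ ∑' i, Measure.hausdorffMeasure (m : ℝ) (S ∩ T i ∩ {x | u x = t}) :=
          measure_iUnion_le _
      _ ≤ _ := ENNReal.tsum_le_tsum fun i => hg i t
  · rw [lintegral_tsum fun i => (hgm i).aemeasurable]
    refine (ENNReal.tsum_le_tsum hgi).trans ?_
    rw [ENNReal.tsum_mul_left]
    conv_rhs => rw [hU]
    rw [measure_iUnion (fun i j hij => (hTd hij).mono inter_subset_right inter_subset_right)
      fun i => hS.inter (hTm i)]

theorem exists_lipschitzWith_eqOn_closedBall {n : ℕ} {u : Space n → ℝ} (hu : LocallyLipschitz u)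
    (R : ℝ) : ∃ (K : ℝ≥0) (v : Space n → ℝ), LipschitzWith K v ∧
      EqOn u v (Metric.closedBall 0 R) := by
  obtain ⟨K, hK⟩ := (hu.locallyLipschitzOn (s := Metric.closedBall 0 R)
    ).exists_lipschitzOnWith_of_compact (isCompact_closedBall 0 R)
  exact ⟨K, hK.extend_real⟩

theorem ae_differentiableAt_of_locallyLipschitz {n : ℕ} {u : Space n → ℝ}
    (hu : LocallyLipschitz u) : ∀ᵐ x, DifferentiableAt ℝ u x := by
  have h : ∀ k : ℕ, ∀ᵐ x : Space n, x ∈ Metric.ball 0 k → DifferentiableAt ℝ u x := by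
    intro k
    obtain ⟨K, v, hv, huv⟩ := exists_lipschitzWith_eqOn_closedBall hu k
    filter_upwards [hv.ae_differentiableAt] with x hx hxk
    refine hx.congr_of_eventuallyEq ?_
    filter_upwards [Metric.isOpen_ball.mem_nhds hxk] with y hy
    exact huv (Metric.ball_subset_closedBall hy)
  filter_upwards [ae_all_iff.2 h] with x hx
  obtain ⟨k, hk⟩ := exists_nat_gt ‖x‖
  exact hx k (by simpa using hk)

/-- Almost every level set of a locally Lipschitz function consists, up to a null set, of points at
which the function is differentiable with nonzero derivative. -/
theorem ae_hausdorffMeasure_level_diff_regularPoints {m : ℕ} {u : Space (m + 1) → ℝ}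
    (hu : LocallyLipschitz u) :
    ∀ᵐ t, Measure.hausdorffMeasure (m : ℝ) ({x | u x = t} \ regularPoints u) = 0 := by
  have h1 : ∀ k : ℕ, ∀ᵐ t, Measure.hausdorffMeasure (m : ℝ)
      ((Metric.closedBall 0 k ∩ {x | ¬ DifferentiableAt ℝ u x}) ∩ {x | u x = t}) = 0 := by
    intro k
    obtain ⟨K, hK⟩ := (hu.locallyLipschitzOn (s := Metric.closedBall 0 (k : ℝ))
      ).exists_lipschitzOnWith_of_compact (isCompact_closedBall 0 _)
    refine ae_hausdorffMeasure_slice_eq_zero_of_volume_eq_zero (hK.mono inter_subset_left) ?_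
    exact measure_mono_null inter_subset_right (ae_differentiableAt_of_locallyLipschitz hu)
  have h2 : ∀ k : ℕ, ∀ᵐ t, Measure.hausdorffMeasure (m : ℝ)
      ((Metric.closedBall 0 k ∩ ({x | DifferentiableAt ℝ u x} ∩ fderiv ℝ u ⁻¹' {0})) ∩
        {x | u x = t}) = 0 := by
    intro k
    refine ae_hausdorffMeasure_slice_eq_zero_of_fderiv_eq_zero ?_
      (Metric.isBounded_closedBall.subset inter_subset_left) fun x hx => ?_
    · exact Metric.isClosed_closedBall.measurableSet.inter
        ((measurableSet_of_differentiableAt ℝ u).inter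
          (measurable_fderiv ℝ u (measurableSet_singleton 0)))
    · have := hx.2.1.hasFDerivAt
      rwa [show fderiv ℝ u x = 0 from hx.2.2] at this
  filter_upwards [ae_all_iff.2 h1, ae_all_iff.2 h2] with t ht1 ht2
  refine measure_mono_null (t := ⋃ k : ℕ,
    (((Metric.closedBall 0 k ∩ {x | ¬ DifferentiableAt ℝ u x}) ∩ {x | u x = t}) ∪
      ((Metric.closedBall 0 k ∩ ({x | DifferentiableAt ℝ u x} ∩ fderiv ℝ u ⁻¹' {0})) ∩
        {x | u x = t}))) (fun x hx => ?_)
    (measure_iUnion_null fun k => measure_union_null (ht1 k) (ht2 k))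
  obtain ⟨k, hk⟩ := exists_nat_gt ‖x‖
  have hxk : x ∈ Metric.closedBall (0 : Space (m + 1)) k := by simpa using hk.le
  refine mem_iUnion.2 ⟨k, ?_⟩
  by_cases hd : DifferentiableAt ℝ u x
  · refine Or.inr ⟨⟨hxk, hd, ?_⟩, hx.1⟩
    by_contra h0
    exact hx.2 ⟨hd, h0⟩
  · exact Or.inl ⟨⟨hxk, hd⟩, hx.1⟩

/-! ### Disintegration along the level sets -/

/-- The Hausdorff measure on the regular part of a level set. -/
noncomputable def levelMeasure {m : ℕ} (u : Space (m + 1) → ℝ) (t : ℝ) : Measure (Space (m + 1)) :=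
  (Measure.hausdorffMeasure (m : ℝ)).restrict (regularPoints u ∩ {x | u x = t})

theorem levelMeasure_apply {m : ℕ} (u : Space (m + 1) → ℝ) (t : ℝ) {s : Set (Space (m + 1))}
    (hs : MeasurableSet s) : levelMeasure u t s =
      Measure.hausdorffMeasure (m : ℝ) ((s ∩ regularPoints u) ∩ {x | u x = t}) := by
  rw [levelMeasure, Measure.restrict_apply hs, inter_assoc]

theorem measurable_levelMeasure {m : ℕ} {c : ℝ≥0} (hc : IsSliceConstant m c)
    {u : Space (m + 1) → ℝ} (hu : Continuous u) : Measurable (levelMeasure u) := by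
  refine Measure.measurable_of_measurable_coe _ fun s hs => ?_
  simp_rw [levelMeasure_apply u _ hs]
  exact (coarea_of_subset_regularPoints hc hu (hs.inter (measurableSet_regularPoints u))
    inter_subset_right).1

/-- The coarea formula as an identity of measures, from which the version for integrable functions
follows by Fubini's theorem for kernels. -/
theorem bind_levelMeasure {m : ℕ} {c : ℝ≥0} (hc : IsSliceConstant m c)
    {u : Space (m + 1) → ℝ} (hu : Continuous u) :
    (volume : Measure ℝ).bind (levelMeasure u) =
      c • volume.withDensity fun x => (‖fderiv ℝ u x‖₊ : ℝ≥0∞) := by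
  ext s hs
  rw [Measure.bind_apply hs (measurable_levelMeasure hc hu).aemeasurable]
  simp_rw [levelMeasure_apply u _ hs]
  rw [(coarea_of_subset_regularPoints hc hu (hs.inter (measurableSet_regularPoints u))
    inter_subset_right).2, Measure.smul_apply, withDensity_apply _ hs]
  -- Off the regular points `fderiv ℝ u x` is zero, either truly or as the default value at points
  -- of non-differentiability.
  have h0 : ∫⁻ x in s \ regularPoints u, ‖fderiv ℝ u x‖ₑ = 0 := by
    rw [setLIntegral_eq_zero_iff (hs.diff (measurableSet_regularPoints u))
      (measurable_fderiv ℝ u).enorm]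
    refine Eventually.of_forall fun x hx => ?_
    by_cases hd : DifferentiableAt ℝ u x
    · have : fderiv ℝ u x = 0 := by
        by_contra h; exact hx.2 ⟨hd, h⟩
      change (‖fderiv ℝ u x‖₊ : ℝ≥0∞) = 0
      rw [this, nnnorm_zero, ENNReal.coe_zero]
    · change (‖fderiv ℝ u x‖₊ : ℝ≥0∞) = 0
      rw [fderiv_zero_of_not_differentiableAt hd, nnnorm_zero, ENNReal.coe_zero]
  have h1 := lintegral_inter_add_diff (μ := volume) (fun x => ‖fderiv ℝ u x‖ₑ) s
    (measurableSet_regularPoints u)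
  rw [h0, add_zero] at h1
  rw [h1]
  rfl

/-- The coarea formula for integrable functions. -/
theorem integral_coarea {m : ℕ} {c : ℝ≥0} (hc : IsSliceConstant m c)
    {u : Space (m + 1) → ℝ} (hu : Continuous u) {h : Space (m + 1) → ℝ}
    (hh : Integrable fun x => ‖fderiv ℝ u x‖ * h x) :
    Integrable (fun t => ∫ x, h x ∂(levelMeasure u t)) ∧
      ∫ t, ∫ x, h x ∂(levelMeasure u t) = c * ∫ x, ‖fderiv ℝ u x‖ * h x := by
  let η : ProbabilityTheory.Kernel ℝ (Space (m + 1)) :=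
    ⟨levelMeasure u, measurable_levelMeasure hc hu⟩
  -- Lebesgue measure on the parameters, seen as a constant kernel, makes the mixture of level
  -- measures a composition of kernels.
  let κ : ProbabilityTheory.Kernel Unit ℝ := ProbabilityTheory.Kernel.const Unit volume
  have hcomp : (η.comp κ) () = c • volume.withDensity fun x => (‖fderiv ℝ u x‖₊ : ℝ≥0∞) := by
    rw [ProbabilityTheory.Kernel.comp_apply]
    exact bind_levelMeasure hc hu
  have hm : Measurable fun x => ‖fderiv ℝ u x‖₊ := (measurable_fderiv ℝ u).nnnorm
  have hint : Integrable h ((η.comp κ) ()) := by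
    rw [hcomp]
    refine Integrable.smul_measure_nnreal ?_
    rw [integrable_withDensity_iff_integrable_smul hm]
    exact hh
  refine ⟨hint.integral_comp, ?_⟩
  have := ProbabilityTheory.Kernel.integral_comp hint
  rw [hcomp, integral_smul_nnreal_measure, integral_withDensity_eq_integral_smul hm] at this
  exact this.symm

/-- The mixture of the level measures is `c|∇u| dx`, finite on balls because `|∇u|` is locally
bounded; hence almost every slice is finite on all balls of integer radius. -/
theorem ae_isLocallyFiniteMeasure_levelMeasure {m : ℕ} {c : ℝ≥0} (hc : IsSliceConstant m c)
    {u : Space (m + 1) → ℝ} (hu : LocallyLipschitz u) :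
    ∀ᵐ t, ∀ R : ℝ, levelMeasure u t (Metric.closedBall 0 R) < ⊤ := by
  have h : ∀ k : ℕ, ∀ᵐ t, levelMeasure u t (Metric.closedBall 0 k) < ⊤ := by
    intro k
    have hmeas : MeasurableSet (Metric.closedBall (0 : Space (m + 1)) k) :=
      Metric.isClosed_closedBall.measurableSet
    refine ae_lt_top ((Measure.measurable_coe hmeas).comp
      (measurable_levelMeasure hc hu.continuous)) ?_
    have h1 := Measure.bind_apply hmeas
      (measurable_levelMeasure hc hu.continuous).aemeasurable (m := (volume : Measure ℝ))
    change ∫⁻ t, levelMeasure u t (Metric.closedBall 0 k) ≠ ⊤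
    rw [← h1, bind_levelMeasure hc hu.continuous, Measure.smul_apply, withDensity_apply _ hmeas]
    refine ENNReal.mul_ne_top ENNReal.coe_ne_top ?_
    obtain ⟨K, v, hv, huv⟩ := exists_lipschitzWith_eqOn_closedBall hu (k + 1)
    refine ne_top_of_le_ne_top (b := K * volume (Metric.closedBall (0 : Space (m + 1)) k))
      (ENNReal.mul_ne_top ENNReal.coe_ne_top Metric.isBounded_closedBall.measure_lt_top.ne) ?_
    rw [← setLIntegral_const]
    refine setLIntegral_mono measurable_const fun x hx => ?_
    have heq : fderiv ℝ u x = fderiv ℝ v x := by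
      refine Filter.EventuallyEq.fderiv_eq ?_
      have hx1 : x ∈ Metric.ball (0 : Space (m + 1)) (k + 1) :=
        Metric.closedBall_subset_ball (by linarith) hx
      filter_upwards [Metric.isOpen_ball.mem_nhds hx1] with y hy
      exact huv (Metric.ball_subset_closedBall hy)
    rw [heq, ENNReal.coe_le_coe]
    exact norm_fderiv_le_of_lipschitz ℝ hv
  filter_upwards [ae_all_iff.2 h] with t ht R
  obtain ⟨k, hk⟩ := exists_nat_gt R
  exact (measure_mono (Metric.closedBall_subset_closedBall hk.le)).trans_lt (ht k)


/-! ### Minkowski norms -/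

namespace IsMinkowskiNorm

variable {n : ℕ} {F : Space n → ℝ}

theorem map_zero (hF : IsMinkowskiNorm F) : F 0 = 0 := by
  simpa using hF.homogeneous 0 0 le_rfl

theorem nonneg (hF : IsMinkowskiNorm F) (x : Space n) : 0 ≤ F x := by
  rcases eq_or_ne x 0 with rfl | h
  · exact hF.map_zero.ge
  · exact (hF.pos x h).le

theorem add_le (hF : IsMinkowskiNorm F) (x y : Space n) : F (x + y) ≤ F x + F y := by
  have h := hF.convex.2 (mem_univ ((2 : ℝ) • x)) (mem_univ ((2 : ℝ) • y))
    (by norm_num : (0 : ℝ) ≤ 1 / 2) (by norm_num : (0 : ℝ) ≤ 1 / 2) (by norm_num)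
  rw [smul_smul, smul_smul, hF.homogeneous 2 x zero_le_two, hF.homogeneous 2 y zero_le_two] at h
  norm_num at h
  linarith

theorem exists_le_mul_norm (hF : IsMinkowskiNorm F) : ∃ C : ℝ≥0, ∀ x, F x ≤ C * ‖x‖ := by
  obtain ⟨C, hC⟩ := (isCompact_closedBall (0 : Space n) 1).exists_bound_of_continuousOn
    hF.convex.locallyLipschitz.continuous.continuousOn
  refine ⟨C.toNNReal, fun x => ?_⟩
  rcases eq_or_ne x 0 with rfl | h
  · simp [hF.map_zero]
  have hx : 0 < ‖x‖ := norm_pos_iff.2 h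
  have h1 : F x = ‖x‖ * F (‖x‖⁻¹ • x) := by
    rw [← hF.homogeneous _ _ (norm_nonneg x), smul_smul, mul_inv_cancel₀ hx.ne', one_smul]
  have h2 : F (‖x‖⁻¹ • x) ≤ C := by
    refine (le_abs_self _).trans (hC _ ?_)
    simp [norm_smul, hx.ne']
  rw [h1, mul_comm]
  gcongr
  exact h2.trans (Real.le_coe_toNNReal C)

theorem exists_lipschitzWith (hF : IsMinkowskiNorm F) : ∃ C : ℝ≥0, LipschitzWith C F := by
  obtain ⟨C, hC⟩ := hF.exists_le_mul_norm
  refine ⟨C, LipschitzWith.of_le_add_mul C fun x y => ?_⟩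
  have h1 := hF.add_le y (x - y)
  rw [add_sub_cancel] at h1
  rw [dist_eq_norm]
  linarith [hC (x - y)]

theorem differentiableAt (hF : IsMinkowskiNorm F) {x : Space n} (hx : x ≠ 0) :
    DifferentiableAt ℝ F x :=
  (hF.smooth.contDiffAt (isOpen_compl_singleton.mem_nhds hx)).differentiableAt (by simp)

/-- Euler's identity: differentiate `F(rx) = rF(x)` at `r = 1`. It is what makes the `ψ'` terms
cancel later. -/
theorem fderiv_apply_self (hF : IsMinkowskiNorm F) {x : Space n} (hx : x ≠ 0) :
    fderiv ℝ F x x = F x := by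
  have h1 : HasDerivAt (fun r : ℝ => F (r • x)) (fderiv ℝ F x x) 1 := by
    have h2 : HasDerivAt (fun r : ℝ => r • x) x 1 := by
      simpa using (hasDerivAt_id (1 : ℝ)).smul_const x
    have h3 : HasFDerivAt F (fderiv ℝ F x) ((1 : ℝ) • x) := by
      rw [one_smul]; exact (hF.differentiableAt hx).hasFDerivAt
    exact h3.comp_hasDerivAt 1 h2
  have h2 : HasDerivAt (fun r : ℝ => F (r • x)) (F x) 1 := by
    have h3 : HasDerivAt (fun r : ℝ => r * F x) (F x) 1 := by
      simpa using (hasDerivAt_id (1 : ℝ)).mul_const (F x)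
    refine h3.congr_of_eventuallyEq ?_
    filter_upwards [lt_mem_nhds (zero_lt_one (α := ℝ))] with r hr
    exact hF.homogeneous r x hr.le
  exact h1.unique h2

/-- The derivative is homogeneous of degree zero, so `F_ξ(∇u)` depends only on the normal direction
`∇u/|∇u|`. -/
theorem fderiv_smul (hF : IsMinkowskiNorm F) {r : ℝ} (hr : 0 < r) {x : Space n} (hx : x ≠ 0) :
    fderiv ℝ F (r • x) = fderiv ℝ F x := by
  have h1 : HasFDerivAt (fun y => F (r • y)) ((fderiv ℝ F (r • x)).comp
      (r • ContinuousLinearMap.id ℝ (Space n))) x :=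
    HasFDerivAt.comp x (hF.differentiableAt (smul_ne_zero hr.ne' hx)).hasFDerivAt
      ((hasFDerivAt_id x).const_smul r)
  have h2 : HasFDerivAt (fun y => F (r • y)) (r • fderiv ℝ F x) x := by
    have h3 : (fun y => F (r • y)) = fun y => r • F y := by
      ext y; exact hF.homogeneous r y hr.le
    rw [h3]
    exact (hF.differentiableAt hx).hasFDerivAt.const_smul r
  have h3 := h1.unique h2
  ext v
  have h4 := congrArg (fun T : Space n →L[ℝ] ℝ => T v) h3
  simp only [ContinuousLinearMap.comp_apply, ContinuousLinearMap.smul_apply,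
    ContinuousLinearMap.id_apply, _root_.map_smul, smul_eq_mul] at h4
  exact mul_left_cancel₀ hr.ne' h4

theorem gradient_smul (hF : IsMinkowskiNorm F) {r : ℝ} (hr : 0 < r) {x : Space n} (hx : x ≠ 0) :
    gradient F (r • x) = gradient F x := by
  rw [gradient, gradient, hF.fderiv_smul hr hx]

end IsMinkowskiNorm

/-! ### First-order expansion of the transported energy density -/

theorem measurable_gradient {n : ℕ} (f : Space n → ℝ) : Measurable (gradient f) :=
  (InnerProductSpace.toDual ℝ (Space n)).symm.continuous.measurable.comp (measurable_fderiv ℝ f)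

theorem inner_gradient {n : ℕ} (f : Space n → ℝ) (x v : Space n) :
    inner ℝ (gradient f x) v = fderiv ℝ f x v := by
  simp [gradient]

theorem norm_gradient {n : ℕ} (f : Space n → ℝ) (x : Space n) :
    ‖gradient f x‖ = ‖fderiv ℝ f x‖ := by
  simp [gradient]

/-- The trace of an endomorphism in the standard basis. -/
noncomputable def trace {n : ℕ} (A : Space n →L[ℝ] Space n) : ℝ :=
  ∑ i, (A (EuclideanSpace.single i 1)) i

theorem det_eq_det_of {n : ℕ} (A : Space n →L[ℝ] Space n) :
    A.det = (Matrix.of fun i j => (A (EuclideanSpace.single j 1)) i).det := by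
  rw [ContinuousLinearMap.det,
    ← LinearMap.det_toMatrix (EuclideanSpace.basisFun (Fin n) ℝ).toBasis]
  congr 1

theorem contDiff_det {n : ℕ} : ContDiff ℝ 1 fun A : Space n →L[ℝ] Space n => A.det := by
  simp_rw [det_eq_det_of, Matrix.det_apply]
  refine ContDiff.sum fun σ _ => ContDiff.const_smul _ (contDiff_prod fun i _ => ?_)
  simp only [Matrix.of_apply]
  exact (contDiff_piLp_apply (𝕜 := ℝ) (p := 2) (E := fun _ : Fin n => ℝ) (i := σ i)).comp
    (contDiff_id.clm_apply contDiff_const)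

/-- The determinant is `1 + s tr A + s²q(s)` with `q` a polynomial. -/
theorem hasDerivAt_det_one_add_smul {n : ℕ} (A : Space n →L[ℝ] Space n) :
    HasDerivAt (fun s : ℝ => (1 + s • A).det) (trace A) 0 := by
  set M : Matrix (Fin n) (Fin n) ℝ := Matrix.of fun i j => (A (EuclideanSpace.single j 1)) i
  have h1 : ∀ s : ℝ, (1 + s • A).det = (1 + s • M).det := by
    intro s
    rw [det_eq_det_of]
    congr 1
    ext i j
    simp [M, Matrix.one_apply]
  have h5 : (fun s : ℝ => (1 + s • A).det) = fun s => 1 + M.trace * s + (Polynomial.eval s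
      ((1 + (Polynomial.X : Polynomial ℝ) • M.map Polynomial.C).det.divX.divX)) * s ^ 2 := by
    ext s
    rw [h1, Matrix.det_one_add_smul]
  rw [h5]
  have h2 : trace A = M.trace := rfl
  have h3 : HasDerivAt (fun s : ℝ => 1 + M.trace * s) M.trace 0 := by
    simpa using ((hasDerivAt_id (0 : ℝ)).const_mul M.trace).const_add 1
  have h4 : HasDerivAt (fun s : ℝ =>
      (Polynomial.eval s ((1 + (Polynomial.X : Polynomial ℝ) • M.map Polynomial.C).det.divX.divX)) *
        s ^ 2) 0 0 := by
    have := (Polynomial.hasDerivAt ((1 + (Polynomial.X : Polynomial ℝ) •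
      M.map Polynomial.C).det.divX.divX) (0 : ℝ)).mul (hasDerivAt_pow 2 (0 : ℝ))
    refine this.congr_deriv ?_
    ring
  rw [h2]
  exact (h3.add h4).congr_deriv (add_zero _)

/-- The composition of the linear form `⟨p, ·⟩` with `(1 + sA)⁻¹`, as a vector. -/
noncomputable def pulledGradient {n : ℕ} (A : Space n →L[ℝ] Space n) (p : Space n) (s : ℝ) :
    Space n :=
  (InnerProductSpace.toDual ℝ (Space n)).symm
    ((InnerProductSpace.toDual ℝ (Space n) p).comp (Ring.inverse (1 + s • A)))

/-- The density of the transported energy. -/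
noncomputable def transportDensity {n : ℕ} (F : Space n → ℝ) (A : Space n →L[ℝ] Space n)
    (p : Space n) (s : ℝ) : ℝ :=
  F (pulledGradient A p s) * |(1 + s • A).det|

theorem pulledGradient_zero {n : ℕ} (A : Space n →L[ℝ] Space n) (p : Space n) :
    pulledGradient A p 0 = p := by
  have h : 1 + (0 : ℝ) • A = 1 := by ext; simp
  rw [pulledGradient, h, Ring.inverse_one]
  exact (InnerProductSpace.toDual ℝ (Space n)).symm_apply_apply p

theorem transportDensity_zero {n : ℕ} (F : Space n → ℝ) (A : Space n →L[ℝ] Space n)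
    (p : Space n) : transportDensity F A p 0 = F p := by
  simp [transportDensity, pulledGradient_zero, ContinuousLinearMap.det]

theorem hasDerivAt_ringInverse_one_add_smul {R : Type*} [NormedRing R] [NormedAlgebra ℝ R]
    [CompleteSpace R] (a : R) :
    HasDerivAt (fun s : ℝ => Ring.inverse (1 + s • a)) (-a) 0 := by
  have h1 : HasDerivAt (fun s : ℝ => 1 + s • a) a 0 := by
    simpa using ((hasDerivAt_id (0 : ℝ)).smul_const a).const_add 1
  have h2 : HasFDerivAt Ring.inverse (-ContinuousLinearMap.mulLeftRight ℝ R 1 1)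
      ((1 : R) + (0 : ℝ) • a) := by
    have := hasFDerivAt_ringInverse (𝕜 := ℝ) (1 : Rˣ)
    simpa using this
  have h3 := h2.comp_hasDerivAt 0 h1
  simpa [Function.comp_def] using h3

theorem hasDerivAt_pulledGradient {n : ℕ} (A : Space n →L[ℝ] Space n) (p : Space n) :
    HasDerivAt (pulledGradient A p) (-((InnerProductSpace.toDual ℝ (Space n)).symm
      ((InnerProductSpace.toDual ℝ (Space n) p).comp A))) 0 := by
  have h3 := hasDerivAt_ringInverse_one_add_smul A
  have h4 := (((ContinuousLinearMap.compL ℝ (Space n) (Space n) ℝ)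
    (InnerProductSpace.toDual ℝ (Space n) p)).hasFDerivAt).comp_hasDerivAt 0 h3
  have h5 := ((InnerProductSpace.toDual ℝ (Space n)).symm.toContinuousLinearEquiv.toContinuousLinearMap.restrictScalars ℝ).hasFDerivAt.comp_hasDerivAt 0 h4
  refine h5.congr_deriv ?_
  simp

/-- The pulled-back covector has derivative `-Aᵀp` and the determinant has derivative `tr A`;
combine by the product rule. At `p = 0` the differentiability of `F` is not available, but the
density is identically zero in `s`. -/
theorem IsMinkowskiNorm.hasDerivAt_transportDensity {n : ℕ} {F : Space n → ℝ}
    (hF : IsMinkowskiNorm F) (A : Space n →L[ℝ] Space n) (p : Space n) :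
    HasDerivAt (transportDensity F A p) (F p * trace A - inner ℝ p (A (gradient F p))) 0 := by
  rcases eq_or_ne p 0 with rfl | hp
  · have h : transportDensity F A 0 = fun _ => 0 := by
      ext s
      simp [transportDensity, pulledGradient, hF.map_zero]
    rw [h]
    simpa [hF.map_zero] using hasDerivAt_const (0 : ℝ) (0 : ℝ)
  have h1 : HasDerivAt (fun s => F (pulledGradient A p s)) (-inner ℝ p (A (gradient F p))) 0 := by
    have h2 : HasFDerivAt F (fderiv ℝ F p) (pulledGradient A p 0) := by
      rw [pulledGradient_zero]; exact (hF.differentiableAt hp).hasFDerivAt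
    have h3 := h2.comp_hasDerivAt 0 (hasDerivAt_pulledGradient A p)
    refine h3.congr_deriv ?_
    rw [map_neg, ← inner_gradient, real_inner_comm, InnerProductSpace.toDual_symm_apply]
    simp
  have h2 : HasDerivAt (fun s : ℝ => |(1 + s • A).det|) (trace A) 0 := by
    have hd := hasDerivAt_det_one_add_smul A
    have h0 : (1 + (0 : ℝ) • A).det = 1 := by simp [ContinuousLinearMap.det]
    have hpos : ∀ᶠ s in 𝓝 (0 : ℝ), 0 < (1 + s • A).det :=
      hd.continuousAt.eventually (lt_mem_nhds (by beta_reduce; rw [h0]; exact one_pos))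
    exact hd.congr_of_eventuallyEq (hpos.mono fun s hs => abs_of_pos hs)
  have h3 := h1.mul h2
  have h0 : |(1 + (0 : ℝ) • A).det| = 1 := by simp [ContinuousLinearMap.det]
  rw [h0, pulledGradient_zero] at h3
  refine h3.congr_deriv ?_
  ring

/-- The dominating bound for differentiation under the integral. It uses only that `F` is Lipschitz
and that inversion and the determinant are Lipschitz near the identity, so it is uniform in `p`,
also near `p = 0`. -/
theorem IsMinkowskiNorm.exists_abs_transportDensity_sub_le {n : ℕ} {F : Space n → ℝ}
    (hF : IsMinkowskiNorm F) (L C : ℝ) (hL : 0 ≤ L) (hC : 0 ≤ C) :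
    ∃ δ > 0, ∃ B : ℝ, 0 ≤ B ∧ ∀ s : ℝ, |s| < δ → ∀ (A : Space n →L[ℝ] Space n) (p : Space n),
      ‖A‖ ≤ L → ‖p‖ ≤ C → |transportDensity F A p s - F p| ≤ B * |s| := by
  obtain ⟨K, hK⟩ := hF.exists_lipschitzWith
  have hinv : ContDiffAt ℝ 1 Ring.inverse (1 : Space n →L[ℝ] Space n) :=
    contDiffAt_ringInverse ℝ (1 : (Space n →L[ℝ] Space n)ˣ)
  obtain ⟨K₁, t₁, ht₁, hK₁⟩ := hinv.exists_lipschitzOnWith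
  obtain ⟨K₂, t₂, ht₂, hK₂⟩ :=
    (contDiff_det (n := n)).contDiffAt (x := 1) |>.exists_lipschitzOnWith
  obtain ⟨r, hr, hrt⟩ := Metric.mem_nhds_iff.1 (inter_mem ht₁ ht₂)
  have hL1 : 0 < L + 1 := by linarith
  -- With `|s| < r/(L + 1)`, the operator `1 + s • A` stays in the ball of radius `r` around `1`
  -- where both Lipschitz bounds hold; `L + 1` also covers `L = 0`.
  refine ⟨r / (L + 1), by positivity,
    K * (C * (K₁ * L)) * (1 + K₂ * r) + K * C * (K₂ * L), by positivity,
    fun s hs A p hA hp => ?_⟩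
  have hsA : ‖s • A‖ ≤ |s| * L := by rw [norm_smul, Real.norm_eq_abs]; gcongr
  have hsr : |s| * L < r := by
    rw [lt_div_iff₀ hL1] at hs
    nlinarith [abs_nonneg s]
  have hmem : 1 + s • A ∈ t₁ ∩ t₂ := hrt (by
    rw [Metric.mem_ball, dist_eq_norm, add_sub_cancel_left]; exact hsA.trans_lt hsr)
  have hmem1 : (1 : Space n →L[ℝ] Space n) ∈ t₁ ∩ t₂ := hrt (Metric.mem_ball_self hr)
  have h1 : ‖Ring.inverse (1 + s • A) - 1‖ ≤ K₁ * (|s| * L) := by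
    have := hK₁.dist_le_mul _ hmem.1 _ hmem1.1
    rw [dist_eq_norm, dist_eq_norm, add_sub_cancel_left, Ring.inverse_one] at this
    exact this.trans (by gcongr)
  have h2 : |(1 + s • A).det - 1| ≤ K₂ * (|s| * L) := by
    have := hK₂.dist_le_mul _ hmem.2 _ hmem1.2
    rw [dist_eq_norm, dist_eq_norm, add_sub_cancel_left] at this
    have h0 : (1 : Space n →L[ℝ] Space n).det = 1 := by simp [ContinuousLinearMap.det]
    rw [h0] at this
    exact this.trans (by gcongr)
  have h3 : ‖pulledGradient A p s - p‖ ≤ C * (K₁ * (|s| * L)) := by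
    have h4 : pulledGradient A p s - p = (InnerProductSpace.toDual ℝ (Space n)).symm
        ((InnerProductSpace.toDual ℝ (Space n) p).comp (Ring.inverse (1 + s • A) - 1)) := by
      rw [ContinuousLinearMap.comp_sub, map_sub]
      congr 1
      exact ((InnerProductSpace.toDual ℝ (Space n)).symm_apply_apply p).symm
    rw [h4, LinearIsometryEquiv.norm_map]
    refine (ContinuousLinearMap.opNorm_comp_le _ _).trans ?_
    rw [LinearIsometryEquiv.norm_map]
    gcongr
  have h4 : |F (pulledGradient A p s) - F p| ≤ K * (C * (K₁ * (|s| * L))) := by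
    have := hK.dist_le_mul (pulledGradient A p s) p
    rw [dist_eq_norm, dist_eq_norm] at this
    exact this.trans (by gcongr)
  have h5 : |F p| ≤ K * C := by
    have := hK.dist_le_mul p 0
    rw [dist_eq_norm, dist_eq_norm, hF.map_zero, sub_zero, sub_zero] at this
    exact this.trans (by gcongr)
  have h6 : |(|(1 + s • A).det| - 1)| ≤ K₂ * (|s| * L) := by
    have := abs_abs_sub_abs_le (1 + s • A).det 1
    rw [abs_one] at this
    exact this.trans h2
  have h7 : |(1 + s • A).det| ≤ 1 + K₂ * r := by
    have h8 := (abs_le.1 h6).2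
    have h9 : (K₂ : ℝ) * (|s| * L) ≤ K₂ * r := by gcongr
    linarith
  have h8 : transportDensity F A p s - F p = (F (pulledGradient A p s) - F p) *
      |(1 + s • A).det| + F p * (|(1 + s • A).det| - 1) := by
    rw [transportDensity]; ring
  rw [h8]
  calc |(F (pulledGradient A p s) - F p) * |(1 + s • A).det| + F p * (|(1 + s • A).det| - 1)|
      ≤ |F (pulledGradient A p s) - F p| * |(1 + s • A).det| +
        |F p| * |(|(1 + s • A).det| - 1)| := by
        refine (abs_add_le _ _).trans ?_
        rw [abs_mul, abs_mul, abs_abs]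
    _ ≤ K * (C * (K₁ * (|s| * L))) * (1 + K₂ * r) + K * C * (K₂ * (|s| * L)) := by gcongr
    _ = _ := by ring


/-! ### Inner variations and the first variation identity -/

/-- If `s ↦ ∫ j(s, ·)` has a minimum at `0`, then the integral of the derivative vanishes. -/
theorem integral_deriv_eq_zero_of_isMin {X : Type*} [MeasurableSpace X] {μ : Measure X}
    [IsFiniteMeasure μ] {j : ℝ → X → ℝ} {D : X → ℝ} {δ B : ℝ} (hδ : 0 < δ)
    (hint : ∀ s, |s| < δ → Integrable (j s) μ)
    (hB : ∀ s, |s| < δ → ∀ᵐ x ∂μ, |j s x - j 0 x| ≤ B * |s|)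
    (hD : ∀ᵐ x ∂μ, HasDerivAt (fun s => j s x) (D x) 0)
    (hmin : ∀ s, |s| < δ → ∫ x, j 0 x ∂μ ≤ ∫ x, j s x ∂μ) : ∫ x, D x ∂μ = 0 := by
  have hnear : ∀ᶠ s in 𝓝 (0 : ℝ), |s| < δ := by
    filter_upwards [Metric.ball_mem_nhds (0 : ℝ) hδ] with s hs
    simpa using hs
  have h0 : |(0 : ℝ)| < δ := by simpa using hδ
  have hderiv : HasDerivAt (fun s => ∫ x, j s x ∂μ) (∫ x, D x ∂μ) 0 := by
    rw [hasDerivAt_iff_tendsto_slope_zero]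
    have hlim : Tendsto (fun s : ℝ => ∫ x, s⁻¹ • (j (0 + s) x - j 0 x) ∂μ) (𝓝[≠] 0)
        (𝓝 (∫ x, D x ∂μ)) := by
      refine tendsto_integral_filter_of_dominated_convergence (fun _ => B) ?_ ?_
        (integrable_const B) ?_
      · filter_upwards [nhdsWithin_le_nhds hnear] with s hs
        rw [zero_add]
        exact (((hint s hs).sub (hint 0 h0)).smul s⁻¹).aestronglyMeasurable
      · filter_upwards [nhdsWithin_le_nhds hnear, self_mem_nhdsWithin] with s hs hs0
        filter_upwards [hB s hs] with x hx
        rw [zero_add, norm_smul, norm_inv, Real.norm_eq_abs, Real.norm_eq_abs,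
          inv_mul_le_iff₀ (abs_pos.2 hs0), mul_comm]
        exact hx
      · filter_upwards [hD] with x hx
        exact hasDerivAt_iff_tendsto_slope_zero.1 hx
    refine hlim.congr' ?_
    filter_upwards [nhdsWithin_le_nhds hnear] with s hs
    rw [zero_add, integral_smul, integral_sub (hint s hs) (hint 0 h0)]
  have hmin' : IsLocalMin (fun s => ∫ x, j s x ∂μ) 0 := by
    filter_upwards [hnear] with s hs
    exact hmin s hs
  exact hmin'.hasDerivAt_eq_zero hderiv

/-- A small Lipschitz perturbation of the identity has a Lipschitz inverse. -/
theorem exists_inverse_id_add_smul {n : ℕ} {W : Space n → Space n} {L : ℝ≥0}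
    (hW : LipschitzWith L W) {s : ℝ} (hs : |s| * L ≤ 1 / 2) :
    ∃ Θ : Space n → Space n, LipschitzWith 2 Θ ∧ (∀ y, Θ (y + s • W y) = y) ∧
      ∀ x, Θ x + s • W (Θ x) = x := by
  have hdiff : ∀ x y, ‖(x + s • W x) - (y + s • W y) - (x - y)‖ ≤ 1 / 2 * ‖x - y‖ := by
    intro x y
    have h1 : (x + s • W x) - (y + s • W y) - (x - y) = s • (W x - W y) := by module
    have h2 := hW.dist_le_mul x y
    rw [dist_eq_norm, dist_eq_norm] at h2
    rw [h1, norm_smul, Real.norm_eq_abs]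
    calc |s| * ‖W x - W y‖ ≤ |s| * (L * ‖x - y‖) := by gcongr
      _ = |s| * L * ‖x - y‖ := by ring
      _ ≤ _ := by gcongr
  have happ : ApproximatesLinearOn (fun y => y + s • W y)
      ((ContinuousLinearEquiv.refl ℝ (Space n) : Space n ≃L[ℝ] Space n) :
        Space n →L[ℝ] Space n) univ (1 / 2) := by
    intro x _ y _
    simpa using hdiff x y
  have hsurj : Function.Surjective fun y => y + s • W y := by
    refine happ.surjective ?_
    -- Surjectivity needs `1/2 < ‖id⁻¹‖⁻¹`. The norm of the identity is `1` except on the trivial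
    -- space, which is treated apart.
    rcases subsingleton_or_nontrivial (Space n) with h | h
    · exact Or.inl h
    · right
      have : ‖((ContinuousLinearEquiv.refl ℝ (Space n)).symm : Space n →L[ℝ] Space n)‖₊ = 1 := by
        simpa using nnnorm_one (α := Space n →L[ℝ] Space n)
      rw [this]
      norm_num
  choose Θ hΘ using hsurj
  beta_reduce at hΘ
  have hanti : ∀ x y, ‖x - y‖ ≤ 2 * ‖(x + s • W x) - (y + s • W y)‖ := by
    intro x y
    have h1 := hdiff x y
    have h2 : ‖x - y‖ - ‖(x + s • W x) - (y + s • W y)‖ ≤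
        ‖(x + s • W x) - (y + s • W y) - (x - y)‖ := by
      rw [norm_sub_rev (_ - _) (x - y)]; exact norm_sub_norm_le _ _
    linarith
  refine ⟨Θ, LipschitzWith.of_dist_le_mul fun x y => ?_, fun y => ?_, hΘ⟩
  · have := hanti (Θ x) (Θ y)
    rw [hΘ, hΘ] at this
    simpa [dist_eq_norm] using this
  · have := hanti (Θ (y + s • W y)) y
    rw [hΘ, sub_self, norm_zero, mul_zero] at this
    exact sub_eq_zero.1 (norm_le_zero_iff.1 this)

/-- The relation `Θ s - x = -s W(Θ s)` gives continuity at `0` because `W` is bounded, and then the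
derivative because `W` is continuous; no differentiability of `W` is involved. -/
theorem hasDerivAt_inverse {n : ℕ} {W : Space n → Space n} (hW : Continuous W) {Θ : ℝ → Space n}
    {x : Space n} (h : ∀ᶠ s in 𝓝 (0 : ℝ), Θ s + s • W (Θ s) = x) {M : ℝ}
    (hM : ∀ y, ‖W y‖ ≤ M) : HasDerivAt Θ (-W x) 0 ∧ Θ 0 = x := by
  have h0 : Θ 0 = x := by simpa using h.self_of_nhds
  have hsub : ∀ᶠ s in 𝓝 (0 : ℝ), Θ s - x = s • (-W (Θ s)) := by
    filter_upwards [h] with s hs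
    have h1 : Θ s - x = Θ s - (Θ s + s • W (Θ s)) := by rw [hs]
    rw [h1]
    module
  have hlim : Tendsto Θ (𝓝 0) (𝓝 x) := by
    rw [tendsto_iff_norm_sub_tendsto_zero]
    refine squeeze_zero' (Eventually.of_forall fun _ => norm_nonneg _) (g := fun s => |s| * M) ?_ ?_
    · filter_upwards [hsub] with s hs
      rw [hs, norm_smul, norm_neg, Real.norm_eq_abs]
      gcongr
      exact hM _
    · have : Tendsto (fun s : ℝ => |s| * M) (𝓝 0) (𝓝 (|0| * M)) := by
        apply Continuous.tendsto; fun_prop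
      simpa using this
  refine ⟨?_, h0⟩
  rw [hasDerivAt_iff_tendsto_slope_zero]
  have h1 : Tendsto (fun s => -W (Θ s)) (𝓝[≠] 0) (𝓝 (-W x)) :=
    ((hW.tendsto x).comp (hlim.mono_left nhdsWithin_le_nhds)).neg
  refine h1.congr' ?_
  filter_upwards [nhdsWithin_le_nhds hsub, self_mem_nhdsWithin] with s hs hs0
  rw [zero_add, h0, hs, smul_smul, inv_mul_cancel₀ hs0, one_smul]

/-- Where `W` is differentiable, `1 + sDW` is invertible by the Neumann series, so the continuous
inverse `Θ` is differentiable with the inverse derivative, and the chain rule applies. -/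
theorem gradient_comp_inverse {n : ℕ} {W : Space n → Space n} {u : Space n → ℝ}
    {Θ : Space n → Space n} {s : ℝ} {y : Space n} (hΘ : Continuous Θ)
    (h1 : Θ (y + s • W y) = y) (h2 : ∀ x, Θ x + s • W (Θ x) = x)
    (hW : DifferentiableAt ℝ W y) (hu : DifferentiableAt ℝ u y)
    (hs : ‖s • fderiv ℝ W y‖ < 1) :
    gradient (fun x => u (Θ x)) (y + s • W y) = pulledGradient (fderiv ℝ W y) (gradient u y) s := by
  have hunit : IsUnit (1 + s • fderiv ℝ W y) := by
    have := isUnit_one_sub_of_norm_lt_one (x := -(s • fderiv ℝ W y)) (by rwa [norm_neg])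
    rwa [sub_neg_eq_add] at this
  obtain ⟨U, hU⟩ := hunit
  let T : Space n ≃L[ℝ] Space n := ContinuousLinearEquiv.unitsEquiv ℝ (Space n) U
  have hT : (T : Space n →L[ℝ] Space n) = 1 + s • fderiv ℝ W y := by
    rw [← hU]; rfl
  have hTs : (T.symm : Space n →L[ℝ] Space n) = Ring.inverse (1 + s • fderiv ℝ W y) := by
    rw [← hU, Ring.inverse_unit]; rfl
  have hΨ : HasFDerivAt (fun x => x + s • W x) (T : Space n →L[ℝ] Space n)
      (Θ (y + s • W y)) := by
    rw [hT, h1]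
    exact (hasFDerivAt_id y).add (hW.hasFDerivAt.const_smul s)
  have hΘd : HasFDerivAt Θ (T.symm : Space n →L[ℝ] Space n) (y + s • W y) :=
    HasFDerivAt.of_local_left_inverse hΘ.continuousAt hΨ (Eventually.of_forall h2)
  have hud : HasFDerivAt u (fderiv ℝ u y) (Θ (y + s • W y)) := by
    rw [h1]; exact hu.hasFDerivAt
  have := (hud.comp (y + s • W y) hΘd).fderiv
  rw [pulledGradient, gradient, gradient, LinearIsometryEquiv.apply_symm_apply, ← hTs, ← this]
  rfl

theorem integrableOn_of_abs_le {n : ℕ} {K : Set (Space n)} (hK : IsCompact K) {f : Space n → ℝ}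
    (hf : AEStronglyMeasurable f (volume.restrict K)) {C : ℝ} (hC : ∀ x ∈ K, |f x| ≤ C) :
    IntegrableOn f K :=
  IntegrableOn.of_bound hK.measure_lt_top hf C
    ((ae_restrict_mem hK.measurableSet).mono fun x hx => hC x hx)

theorem norm_gradient_le_of_lipschitzOnWith {n : ℕ} {u : Space n → ℝ} {U : Set (Space n)}
    (hU : IsOpen U) {K : ℝ≥0} (hu : LipschitzOnWith K u U) {x : Space n} (hx : x ∈ U) :
    ‖gradient u x‖ ≤ K := by
  rw [norm_gradient]
  exact norm_fderiv_le_of_lipschitzOn ℝ (hU.mem_nhds hx) hu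

/-- The transport of the energy by a small Lipschitz perturbation of the identity. -/
theorem IsMinkowskiNorm.energy_comp_inverse {n : ℕ} {F : Space n → ℝ} (hF : IsMinkowskiNorm F)
    {u : Space n → ℝ} (hu : LocallyLipschitz u) {W : Space n → Space n} {L : ℝ≥0}
    (hW : LipschitzWith L W) (hWc : HasCompactSupport W) {s : ℝ} (hs : |s| * L ≤ 1 / 2)
    {Θ : Space n → Space n} (hΘL : LipschitzWith 2 Θ) (h1 : ∀ y, Θ (y + s • W y) = y)
    (h2 : ∀ x, Θ x + s • W (Θ x) = x) :
    IntegrableOn (fun y => transportDensity F (fderiv ℝ W y) (gradient u y) s) (tsupport W) ∧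
    IntegrableOn (fun y => u (Θ y) * F (gradient u y)) (tsupport W) ∧
    energy F u (tsupport W) (fun x => u (Θ x)) =
      ∫ y in tsupport W, (transportDensity F (fderiv ℝ W y) (gradient u y) s +
        u (Θ y) * F (gradient u y)) := by
  set K := tsupport W with hKdef
  have hK : IsCompact K := hWc
  have hW0 : ∀ x ∉ K, W x = 0 := fun x hx => image_eq_zero_of_notMem_tsupport hx
  set Ψ : Space n → Space n := fun y => y + s • W y with hΨ
  -- `Ψ` fixes every point outside `K`. If `Ψ y` were outside, then `Ψ (Ψ y) = Ψ y`, and applying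
  -- `Θ` gives `Ψ y = y`, which lies in `K`.
  have hΨK : ∀ y ∈ K, Ψ y ∈ K := by
    intro y hy
    by_contra h
    have h3 : Ψ (Ψ y) = Ψ y := by simp only [hΨ]; rw [hW0 _ h, smul_zero, add_zero]
    have h4 : Θ (Ψ (Ψ y)) = Ψ y := h1 (Ψ y)
    rw [h3] at h4
    rw [h4.symm.trans (h1 y)] at h
    exact h hy
  have hΘK : ∀ x ∈ K, Θ x ∈ K := by
    intro x hx
    by_contra h
    have h3 := h2 x
    rw [hW0 _ h, smul_zero, add_zero] at h3
    rw [h3] at h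
    exact h hx
  have hΨL : LipschitzWith 2 Ψ := LipschitzWith.of_dist_le_mul fun x y => by
    have h3 : Ψ x - Ψ y = (x - y) + s • (W x - W y) := by simp only [hΨ]; module
    have h4 := hW.dist_le_mul x y
    rw [dist_eq_norm, dist_eq_norm] at h4 ⊢
    rw [h3]
    calc ‖(x - y) + s • (W x - W y)‖ ≤ ‖x - y‖ + |s| * (L * ‖x - y‖) := by
          refine (norm_add_le _ _).trans ?_
          rw [norm_smul, Real.norm_eq_abs]
          gcongr
      _ = ‖x - y‖ + |s| * L * ‖x - y‖ := by ring
      _ ≤ ‖x - y‖ + 1 / 2 * ‖x - y‖ := by gcongr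
      _ ≤ (2 : ℝ≥0) * ‖x - y‖ := by push_cast; nlinarith [norm_nonneg (x - y)]
  have hv : LocallyLipschitz fun x => u (Θ x) := hu.comp hΘL.locallyLipschitz
  obtain ⟨R, hR⟩ := hK.isBounded.subset_ball (0 : Space n)
  have hgrad : ∀ w : Space n → ℝ, LocallyLipschitz w → ∃ C : ℝ, ∀ x ∈ K, |F (gradient w x)| ≤ C := by
    intro w hw
    obtain ⟨Kw, hKw⟩ := (hw.locallyLipschitzOn (s := Metric.closedBall 0 R)
      ).exists_lipschitzOnWith_of_compact (isCompact_closedBall 0 R)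
    obtain ⟨C, hC⟩ := hF.exists_le_mul_norm
    refine ⟨C * Kw, fun x hx => ?_⟩
    rw [abs_of_nonneg (hF.nonneg _)]
    refine (hC _).trans ?_
    gcongr
    exact norm_gradient_le_of_lipschitzOnWith Metric.isOpen_ball
      (hKw.mono Metric.ball_subset_closedBall) (hR hx)
  have hFm : Measurable F := hF.convex.locallyLipschitz.continuous.measurable
  have hFv : Measurable fun x => F (gradient (fun x => u (Θ x)) x) :=
    hFm.comp (measurable_gradient _)
  have hFu : Measurable fun x => F (gradient u x) := hFm.comp (measurable_gradient _)
  have hi1 : IntegrableOn (fun x => F (gradient (fun x => u (Θ x)) x)) K := by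
    obtain ⟨C, hC⟩ := hgrad _ hv
    exact integrableOn_of_abs_le hK hFv.aestronglyMeasurable hC
  have hi2 : IntegrableOn (fun x => u (Θ x) * F (gradient u x)) K := by
    obtain ⟨C, hC⟩ := hgrad _ hu
    obtain ⟨C', hC'⟩ := hK.exists_bound_of_continuousOn hv.continuous.continuousOn
    refine integrableOn_of_abs_le hK
      (hv.continuous.measurable.mul hFu).aestronglyMeasurable (C := C' * C) fun x hx => ?_
    rw [abs_mul]
    have h3 := hC' x hx
    rw [Real.norm_eq_abs] at h3
    exact mul_le_mul h3 (hC x hx) (abs_nonneg _) ((abs_nonneg _).trans h3)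
  -- The change of variables is carried out on the points where `W` is differentiable. The rest is
  -- null by Rademacher's theorem, and so is its image under the Lipschitz map `Ψ`.
  set G : Set (Space n) := {x | DifferentiableAt ℝ W x}
  have hGm : MeasurableSet G := measurableSet_of_differentiableAt ℝ W
  have hGae : ∀ᵐ x, x ∈ G := hW.ae_differentiableAt
  have hS : MeasurableSet (K ∩ G) := hK.measurableSet.inter hGm
  have hder : ∀ x ∈ K ∩ G, HasFDerivWithinAt Ψ (1 + s • fderiv ℝ W x) (K ∩ G) x := fun x hx =>
    ((hasFDerivAt_id x).add (hx.2.hasFDerivAt.const_smul s)).hasFDerivWithinAt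
  have hinj : InjOn Ψ (K ∩ G) := fun x _ y _ hxy => by rw [← h1 x, ← h1 y]; exact congrArg Θ hxy
  have hKG : (K ∩ G : Set (Space n)) =ᵐ[volume] K := by
    filter_upwards [hGae] with x hx
    exact propext ⟨fun h => h.1, fun h => ⟨h, hx⟩⟩
  have himg : (Ψ '' (K ∩ G) : Set (Space n)) =ᵐ[volume] K := by
    have hnull : volume (Ψ '' Gᶜ) = 0 := by
      refine le_antisymm ((volume_image_le_of_lipschitzOnWith hΨL.lipschitzOnWith).trans ?_) zero_le
      rw [show volume Gᶜ = 0 from hGae, mul_zero]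
    have hae : ∀ᵐ x, x ∉ Ψ '' Gᶜ := measure_eq_zero_iff_ae_notMem.1 hnull
    filter_upwards [hae] with x hx
    refine propext ⟨?_, fun h => ?_⟩
    · rintro ⟨y, hy, rfl⟩
      exact hΨK y hy.1
    · by_contra hcon
      refine hx ⟨Θ x, fun hG => hcon ⟨Θ x, ⟨hΘK x h, hG⟩, h2 x⟩, h2 x⟩
  have hae : ∀ᵐ y ∂(volume.restrict K),
      |(1 + s • fderiv ℝ W y).det| • F (gradient (fun x => u (Θ x)) (Ψ y)) =
        transportDensity F (fderiv ℝ W y) (gradient u y) s := by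
    refine ae_restrict_of_ae ?_
    filter_upwards [hGae, ae_differentiableAt_of_locallyLipschitz hu] with y hy huy
    have hsm : ‖s • fderiv ℝ W y‖ < 1 := by
      rw [norm_smul, Real.norm_eq_abs]
      have h3 : |s| * ‖fderiv ℝ W y‖ ≤ |s| * L := by
        gcongr; exact norm_fderiv_le_of_lipschitz ℝ hW
      linarith
    rw [gradient_comp_inverse hΘL.continuous (h1 y) h2 hy huy hsm, transportDensity, smul_eq_mul,
      mul_comm]
  have hi3 : IntegrableOn (fun y => transportDensity F (fderiv ℝ W y) (gradient u y) s) K := by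
    have h3 := (integrableOn_image_iff_integrableOn_abs_det_fderiv_smul volume hS hder hinj
      (fun x => F (gradient (fun x => u (Θ x)) x))).1 (hi1.congr_set_ae himg)
    exact (h3.congr_set_ae hKG.symm).congr_fun_ae hae
  refine ⟨hi3, hi2, ?_⟩
  -- Only the gradient term is transported by `x = Ψ y`; the weight `F(∇u)` in the other term is
  -- fixed by the functional and stays in place.
  rw [integral_add hi3 hi2, energy, integral_add hi1 hi2, ← integral_congr_ae hae,
    ← setIntegral_congr_set himg,
    integral_image_eq_integral_abs_det_fderiv_smul volume hS hder hinj,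
    setIntegral_congr_set hKG]

/-- The functions `u ∘ Θ s` are admissible competitors, since `Θ s` is the identity off `tsupport
W`. Their energies are therefore minimal at `s = 0`, and the identity is the vanishing of the
derivative there. -/
theorem IsMinkowskiNorm.integral_firstVariation_eq_zero {n : ℕ} {F : Space n → ℝ}
    (hF : IsMinkowskiNorm F) {u : Space n → ℝ} (hu : LocallyLipschitz u) {Ω : Set (Space n)}
    (hw : IsWeakSolution F Ω u) {W : Space n → Space n} {L : ℝ≥0}
    (hW : LipschitzWith L W) (hWc : HasCompactSupport W) (hWΩ : tsupport W ⊆ Ω) :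
    ∫ x in tsupport W, (F (gradient u x) * trace (fderiv ℝ W x) -
      inner ℝ (gradient u x) (fderiv ℝ W x (gradient F (gradient u x))) -
      F (gradient u x) * inner ℝ (gradient u x) (W x)) = 0 := by
  set K := tsupport W with hKdef
  have hK : IsCompact K := hWc
  have hW0 : ∀ x ∉ K, W x = 0 := fun x hx => image_eq_zero_of_notMem_tsupport hx
  obtain ⟨M, hM⟩ := hW.continuous.bounded_above_of_compact_support hWc
  obtain ⟨R, hR⟩ := hK.isBounded.subset_ball (0 : Space n)
  obtain ⟨Ku, hKu⟩ := (hu.locallyLipschitzOn (s := Metric.closedBall 0 R)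
      ).exists_lipschitzOnWith_of_compact (isCompact_closedBall 0 R)
  have hKu' := hKu.mono Metric.ball_subset_closedBall
  obtain ⟨C, hC⟩ := hF.exists_le_mul_norm
  have hgu : ∀ x ∈ K, ‖gradient u x‖ ≤ Ku := fun x hx =>
    norm_gradient_le_of_lipschitzOnWith Metric.isOpen_ball hKu' (hR hx)
  have hex : ∀ s : ℝ, |s| * L ≤ 1 / 2 → _ := fun s hs => exists_inverse_id_add_smul hW hs
  choose! Θ hΘL hΘ1 hΘ2 using hex
  obtain ⟨δ, hδ, B, hB0, hB⟩ := hF.exists_abs_transportDensity_sub_le L Ku L.2 Ku.2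
  set δ' : ℝ := min δ (1 / (2 * (L + 1)))
  have hδ' : 0 < δ' := lt_min hδ (by positivity)
  have hsmall : ∀ s : ℝ, |s| < δ' → |s| * L ≤ 1 / 2 := by
    intro s hs
    have h1 : |s| < 1 / (2 * (L + 1)) := hs.trans_le (min_le_right _ _)
    rw [lt_div_iff₀ (by positivity)] at h1
    nlinarith [abs_nonneg s]
  have hE := fun s (hs : |s| < δ') => hF.energy_comp_inverse hu hW hWc (hsmall s hs)
    (hΘL s (hsmall s hs)) (hΘ1 s (hsmall s hs)) (hΘ2 s (hsmall s hs))
  have h00 : |(0 : ℝ)| < δ' := by simpa using hδ'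
  have hΘ0 : ∀ x, Θ 0 x = x := fun x => by
    simpa using hΘ1 0 (hsmall 0 h00) x
  have : IsFiniteMeasure (volume.restrict K) := ⟨by simpa using hK.measure_lt_top⟩
  refine integral_deriv_eq_zero_of_isMin (μ := volume.restrict K)
    (j := fun s y => transportDensity F (fderiv ℝ W y) (gradient u y) s +
        u (Θ s y) * F (gradient u y)) (B := B + Ku * M * (C * Ku)) hδ' ?_ ?_ ?_ ?_
  · intro s hs
    exact (hE s hs).1.add (hE s hs).2.1
  · intro s hs
    filter_upwards [ae_restrict_mem hK.measurableSet] with y hy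
    -- Both `y` and `Θ s y` must lie in the ball on which `u` has Lipschitz constant `Ku`.
    have hΘK : Θ s y ∈ K := by
      by_contra h
      have h3 := hΘ2 s (hsmall s hs) y
      rw [hW0 _ h, smul_zero, add_zero] at h3
      exact h (h3.symm ▸ hy)
    have h1 := hB s (hs.trans_le (min_le_left _ _)) (fderiv ℝ W y) (gradient u y)
      (norm_fderiv_le_of_lipschitz ℝ hW) (hgu y hy)
    have h2 : |u (Θ s y) - u y| ≤ Ku * (|s| * M) := by
      have h3 := hKu'.dist_le_mul _ (hR hΘK) _ (hR hy)
      rw [dist_eq_norm, dist_eq_norm] at h3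
      refine h3.trans ?_
      have h4 : Θ s y - y = -(s • W (Θ s y)) := by
        have h5 : Θ s y - y = Θ s y - (Θ s y + s • W (Θ s y)) := by
          rw [hΘ2 s (hsmall s hs) y]
        rw [h5]; abel
      rw [h4, norm_neg, norm_smul, Real.norm_eq_abs]
      gcongr
      exact hM _
    have h3 : |F (gradient u y)| ≤ C * Ku := by
      rw [abs_of_nonneg (hF.nonneg _)]
      exact (hC _).trans (by gcongr; exact hgu y hy)
    have h4 : transportDensity F (fderiv ℝ W y) (gradient u y) s + u (Θ s y) * F (gradient u y) -
        (transportDensity F (fderiv ℝ W y) (gradient u y) 0 + u (Θ 0 y) * F (gradient u y)) =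
        (transportDensity F (fderiv ℝ W y) (gradient u y) s - F (gradient u y)) +
          (u (Θ s y) - u y) * F (gradient u y) := by
      rw [transportDensity_zero, hΘ0]; ring
    rw [h4]
    calc _ ≤ B * |s| + Ku * (|s| * M) * (C * Ku) := by
          refine (abs_add_le _ _).trans (add_le_add h1 ?_)
          rw [abs_mul]
          exact mul_le_mul h2 h3 (abs_nonneg _) ((abs_nonneg _).trans h2)
      _ = _ := by ring
  · refine ae_restrict_of_ae ?_
    filter_upwards [ae_differentiableAt_of_locallyLipschitz hu] with y hy
    have h1 := hF.hasDerivAt_transportDensity (fderiv ℝ W y) (gradient u y)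
    have hnear : ∀ᶠ s in 𝓝 (0 : ℝ), Θ s y + s • W (Θ s y) = y := by
      filter_upwards [Metric.ball_mem_nhds (0 : ℝ) hδ'] with s hs
      exact hΘ2 s (hsmall s (by simpa using hs)) y
    have h2 := hasDerivAt_inverse hW.continuous hnear hM
    have h3 : HasFDerivAt u (fderiv ℝ u y) (Θ 0 y) := by
      rw [hΘ0]; exact hy.hasFDerivAt
    have h4 := (h3.comp_hasDerivAt 0 h2.1).mul_const (F (gradient u y))
    refine (h1.add h4).congr_deriv ?_
    rw [map_neg, ← inner_gradient]
    ring
  · intro s hs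
    have h1 : energy F u K u = ∫ y in K, (transportDensity F (fderiv ℝ W y) (gradient u y) 0 +
        u (Θ 0 y) * F (gradient u y)) := by
      simp_rw [transportDensity_zero, hΘ0]
      rfl
    rw [← h1, ← (hE s hs).2.2]
    refine hw.2 K hK hWΩ _ ((hu.comp (hΘL s (hsmall s hs)).locallyLipschitz).locallyLipschitzOn)
      fun x hx => ?_
    have h2 := hΘ1 s (hsmall s hs) x
    rw [hW0 x hx.2, smul_zero, add_zero] at h2
    rw [h2]


/-! ### Outer normals and frontiers of sublevel sets -/

/-- Leaving `x` in the direction `ν' - ν`, one enters `E` according to `ν` and its complement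
according to `ν'`. -/
theorem IsOuterUnitNormal.eq {n : ℕ} {E : Set (Space n)} {x ν ν' : Space n}
    (h : IsOuterUnitNormal E x ν) (h' : IsOuterUnitNormal E x ν') : ν = ν' := by
  by_contra hne
  have hsq : ‖ν' - ν‖ ^ 2 = 2 - 2 * inner ℝ ν ν' := by
    rw [norm_sub_sq_real, h.1, h'.1, real_inner_comm]; ring
  have hd : 0 < ‖ν' - ν‖ := norm_pos_iff.2 (sub_ne_zero.2 (Ne.symm hne))
  set a : ℝ := 1 - inner ℝ ν ν' with ha
  have ha0 : 0 < a := by nlinarith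
  -- The inner products of `r(ν' - ν)` with `ν` and `ν'` are `-ra` and `ra`; this `ε` makes the cone
  -- threshold `ra/2`.
  have hε : 0 < a / (2 * ‖ν' - ν‖) := by positivity
  have hev := (h.2 _ hε).and (h'.2 _ hε)
  have htend : Tendsto (fun r : ℝ => x + r • (ν' - ν)) (𝓝[>] 0) (𝓝 x) := by
    have : Tendsto (fun r : ℝ => x + r • (ν' - ν)) (𝓝 0) (𝓝 (x + (0 : ℝ) • (ν' - ν))) := by
      apply Continuous.tendsto; fun_prop
    rw [zero_smul, add_zero] at this
    exact this.mono_left nhdsWithin_le_nhds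
  obtain ⟨r, hr, hr0⟩ := ((htend.eventually hev).and self_mem_nhdsWithin).exists
  have hr0' : 0 < r := hr0
  rw [add_sub_cancel_left] at hr
  have hn : a / (2 * ‖ν' - ν‖) * ‖r • (ν' - ν)‖ = r * a / 2 := by
    rw [norm_smul, Real.norm_of_nonneg hr0'.le]; field_simp
  have h1 : inner ℝ ν (r • (ν' - ν)) = -(r * a) := by
    rw [real_inner_smul_right, inner_sub_right, real_inner_self_eq_norm_sq, h.1, ha]; ring
  have h2 : inner ℝ ν' (r • (ν' - ν)) = r * a := by
    rw [real_inner_smul_right, inner_sub_right, real_inner_self_eq_norm_sq, h'.1,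
      real_inner_comm, ha]; ring
  rw [hn, h1, h2] at hr
  have hra : 0 < r * a := mul_pos hr0' ha0
  exact hr.2.2 (by linarith) (hr.1.1 (by linarith))

/-- The normalized gradient. -/
noncomputable def unitNormal {n : ℕ} (u : Space n → ℝ) (x : Space n) : Space n :=
  ‖gradient u x‖⁻¹ • gradient u x

theorem measurable_unitNormal {n : ℕ} (u : Space n → ℝ) : Measurable (unitNormal u) :=
  (measurable_gradient u).norm.inv.smul (measurable_gradient u)

theorem norm_unitNormal_le {n : ℕ} (u : Space n → ℝ) (x : Space n) : ‖unitNormal u x‖ ≤ 1 := by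
  rw [unitNormal, norm_smul, norm_inv, norm_norm]
  exact inv_mul_le_one

theorem norm_smul_unitNormal {n : ℕ} (u : Space n → ℝ) (x : Space n) :
    ‖gradient u x‖ • unitNormal u x = gradient u x := by
  rcases eq_or_ne (gradient u x) 0 with h | h
  · simp [h]
  · rw [unitNormal, smul_smul, mul_inv_cancel₀ (norm_ne_zero_iff.2 h), one_smul]

theorem gradient_ne_zero_of_mem_regularPoints {n : ℕ} {u : Space n → ℝ} {x : Space n}
    (hx : x ∈ regularPoints u) : gradient u x ≠ 0 := by
  rw [← norm_ne_zero_iff, norm_gradient, norm_ne_zero_iff]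
  exact hx.2

theorem norm_unitNormal_of_mem_regularPoints {n : ℕ} {u : Space n → ℝ} {x : Space n}
    (hx : x ∈ regularPoints u) : ‖unitNormal u x‖ = 1 := by
  rw [unitNormal, norm_smul, norm_inv, norm_norm]
  exact inv_mul_cancel₀ (norm_ne_zero_iff.2 (gradient_ne_zero_of_mem_regularPoints hx))

/-- Differentiability with error at most `ε|∇u||y - x|` says that outside the `ε`-cones the sign of
`u y - u x` is that of `⟨ν, y - x⟩`. -/
theorem isOuterUnitNormal_unitNormal {n : ℕ} {u : Space n → ℝ} {x : Space n}
    (hx : x ∈ regularPoints u) : IsOuterUnitNormal {y | u y < u x} x (unitNormal u x) := by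
  refine ⟨norm_unitNormal_of_mem_regularPoints hx, fun ε hε => ?_⟩
  have hp : 0 < ‖gradient u x‖ := norm_pos_iff.2 (gradient_ne_zero_of_mem_regularPoints hx)
  filter_upwards [hx.1.hasFDerivAt.isLittleO.def (mul_pos hε hp)] with y hy
  rw [Real.norm_eq_abs, ← inner_gradient, ← norm_smul_unitNormal, real_inner_smul_left,
    norm_smul_unitNormal] at hy
  have hy' := abs_le.1 hy
  constructor
  · intro h
    have := mul_lt_mul_of_pos_left h hp
    change u y < u x
    nlinarith [hy'.2]
  · intro h hyE
    have := mul_lt_mul_of_pos_left h hp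
    have hyE' : u y < u x := hyE
    nlinarith [hy'.1]

theorem mem_closure_of_isOuterUnitNormal {n : ℕ} {E : Set (Space n)} {x ν : Space n}
    (h : IsOuterUnitNormal E x ν) : x ∈ closure E := by
  have htend : Tendsto (fun r : ℝ => x - r • ν) (𝓝[>] 0) (𝓝 x) := by
    have : Tendsto (fun r : ℝ => x - r • ν) (𝓝 0) (𝓝 (x - (0 : ℝ) • ν)) := by
      apply Continuous.tendsto; fun_prop
    rw [zero_smul, sub_zero] at this
    exact this.mono_left nhdsWithin_le_nhds
  refine mem_closure_of_tendsto htend ?_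
  filter_upwards [htend.eventually (h.2 (1 / 2) (by norm_num)), self_mem_nhdsWithin] with r hr hr0
  have hr0' : 0 < r := hr0
  refine hr.1 ?_
  rw [sub_sub_cancel_left, norm_neg, norm_smul, inner_neg_right, real_inner_smul_right,
    real_inner_self_eq_norm_sq, h.1, Real.norm_of_nonneg hr0'.le]
  linarith

theorem inter_level_subset_frontier {n : ℕ} {u : Space n → ℝ} (t : ℝ) :
    regularPoints u ∩ {x | u x = t} ⊆ frontier {y | u y < t} := by
  rintro x ⟨hx, rfl⟩
  refine ⟨mem_closure_of_isOuterUnitNormal (isOuterUnitNormal_unitNormal hx), fun h => ?_⟩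
  have h1 : x ∈ {y | u y < u x} := interior_subset h
  exact lt_irrefl (u x) h1

/-- The frontier lies in `{u = t}` by continuity and contains all regular points of `{u = t}`; by
hypothesis the remainder is null. -/
theorem surfaceMeasure_frontier_eq_levelMeasure {m : ℕ} {u : Space (m + 1) → ℝ}
    (hu : Continuous u) {t : ℝ}
    (ht : Measure.hausdorffMeasure (m : ℝ) ({x | u x = t} \ regularPoints u) = 0) :
    surfaceMeasure (frontier {y | u y < t}) = levelMeasure u t := by
  have hm : ((m + 1 : ℕ) : ℝ) - 1 = m := by push_cast; ring
  rw [surfaceMeasure, levelMeasure, hm]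
  refine Measure.restrict_congr_set ?_
  have hae : ∀ᵐ x ∂(Measure.hausdorffMeasure (m : ℝ) : Measure (Space (m + 1))),
      x ∉ ({x | u x = t} \ regularPoints u) := measure_eq_zero_iff_ae_notMem.1 ht
  filter_upwards [hae] with x hx
  refine propext ⟨fun h => ?_, fun h => inter_level_subset_frontier t h⟩
  have hxt : u x = t := frontier_lt_subset_eq hu continuous_const h
  exact ⟨by_contra fun hP => hx ⟨hxt, hP⟩, hxt⟩

/-- The anisotropic tangential divergence, times `F(ν)`. -/
noncomputable def weightedDivergence {n : ℕ} (F u : Space n → ℝ) (V : Space n → Space n)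
    (x : Space n) : ℝ :=
  F (unitNormal u x) * trace (fderiv ℝ V x) -
    inner ℝ (unitNormal u x) (fderiv ℝ V x (gradient F (unitNormal u x)))

/-- The integrand of the first variation of the level sets. -/
noncomputable def levelIntegrand {n : ℕ} (F u : Space n → ℝ) (V : Space n → Space n)
    (x : Space n) : ℝ :=
  weightedDivergence F u V x - F (gradient u x) * inner ℝ (V x) (unitNormal u x)

theorem IsMinkowskiNorm.tangentialDivergence_mul {n : ℕ} {F : Space n → ℝ}
    (hF : IsMinkowskiNorm F) {u : Space n → ℝ} (V : Space n → Space n) {x : Space n}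
    (hx : x ∈ regularPoints u) :
    tangentialDivergence F V x (unitNormal u x) * F (unitNormal u x) =
      weightedDivergence F u V x := by
  have hν : unitNormal u x ≠ 0 := norm_ne_zero_iff.1 (by
    rw [norm_unitNormal_of_mem_regularPoints hx]; exact one_ne_zero)
  have hFν := (hF.pos _ hν).ne'
  rw [tangentialDivergence, weightedDivergence, real_inner_smul_right, real_inner_comm]
  change (trace (fderiv ℝ V x) - _) * _ = _
  field_simp

/-- The factor `|∇u|` supplied by the coarea formula is absorbed by homogeneity, so the level-set
integrand becomes the first variation density. Where `∇u = 0` both sides vanish. -/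
theorem IsMinkowskiNorm.norm_mul_levelIntegrand {n : ℕ} {F : Space n → ℝ}
    (hF : IsMinkowskiNorm F) (u : Space n → ℝ) (V : Space n → Space n) (x : Space n) :
    ‖fderiv ℝ u x‖ * levelIntegrand F u V x = F (gradient u x) * trace (fderiv ℝ V x) -
      inner ℝ (gradient u x) (fderiv ℝ V x (gradient F (gradient u x))) -
      F (gradient u x) * inner ℝ (gradient u x) (V x) := by
  rw [← norm_gradient]
  rcases eq_or_ne (gradient u x) 0 with h | h
  · simp [h, hF.map_zero]
  have hpos : 0 < ‖gradient u x‖ := norm_pos_iff.2 h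
  have hν : unitNormal u x ≠ 0 := smul_ne_zero (inv_ne_zero hpos.ne') h
  have h1 : F (gradient u x) = ‖gradient u x‖ * F (unitNormal u x) := by
    rw [← hF.homogeneous _ _ (norm_nonneg _), norm_smul_unitNormal]
  have h2 : gradient F (gradient u x) = gradient F (unitNormal u x) := by
    rw [← hF.gradient_smul hpos hν, norm_smul_unitNormal]
  have h3 : ∀ v, inner ℝ (gradient u x) v = ‖gradient u x‖ * inner ℝ (unitNormal u x) v := by
    intro v
    rw [← real_inner_smul_left, norm_smul_unitNormal]
  rw [h3, h3, h2, levelIntegrand, weightedDivergence, real_inner_comm (V x), h1]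
  ring

/-! ### Test fields of the form `ψ(u)V` -/

theorem trace_add {n : ℕ} (A B : Space n →L[ℝ] Space n) : trace (A + B) = trace A + trace B := by
  simp [trace, Finset.sum_add_distrib]

theorem trace_smul {n : ℕ} (r : ℝ) (A : Space n →L[ℝ] Space n) :
    trace (r • A) = r * trace A := by
  simp [trace, Finset.mul_sum]

theorem trace_sub {n : ℕ} (A B : Space n →L[ℝ] Space n) : trace (A - B) = trace A - trace B := by
  simp [trace, Finset.sum_sub_distrib]

theorem trace_smulRight {n : ℕ} (l : Space n →L[ℝ] ℝ) (v : Space n) :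
    trace (l.smulRight v) = l v := by
  have hv : v = ∑ i, v i • EuclideanSpace.single i (1 : ℝ) := by
    have := (EuclideanSpace.basisFun (Fin n) ℝ).sum_repr v
    simpa using this.symm
  conv_rhs => rw [hv]
  simp [trace, map_sum, mul_comm]

theorem abs_trace_le {n : ℕ} (A : Space n →L[ℝ] Space n) : |trace A| ≤ n * ‖A‖ := by
  refine (Finset.abs_sum_le_sum_abs _ _).trans ?_
  have : ∀ i ∈ Finset.univ, |(A (EuclideanSpace.single i 1)) i| ≤ ‖A‖ := fun i _ => by
    have h1 := PiLp.norm_apply_le (A (EuclideanSpace.single i 1)) i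
    have h2 := A.le_opNorm (EuclideanSpace.single i 1)
    simp only [PiLp.norm_single, norm_one, mul_one] at h2
    exact h1.trans h2
  simpa using Finset.sum_le_sum this

theorem continuous_trace {n : ℕ} : Continuous (trace : (Space n →L[ℝ] Space n) → ℝ) := by
  unfold trace
  fun_prop

theorem exists_lipschitzWith_comp_smul {n : ℕ} {u : Space n → ℝ} (hu : LocallyLipschitz u)
    {V : Space n → Space n} (hV : ContDiff ℝ ∞ V) (hVc : HasCompactSupport V) {ψ : ℝ → ℝ}
    (hψ : ContDiff ℝ ∞ ψ) (hψc : HasCompactSupport ψ) :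
    ∃ L : ℝ≥0, LipschitzWith L fun x => ψ (u x) • V x := by
  obtain ⟨LV, hLV⟩ := ContDiff.lipschitzWith_of_hasCompactSupport hVc hV (by simp)
  obtain ⟨Lψ, hLψ⟩ := ContDiff.lipschitzWith_of_hasCompactSupport hψc hψ (by simp)
  obtain ⟨MV, hMV⟩ := hV.continuous.bounded_above_of_compact_support hVc
  obtain ⟨Mψ, hMψ⟩ := hψ.continuous.bounded_above_of_compact_support hψc
  obtain ⟨R, hR⟩ := hVc.isCompact.isBounded.subset_closedBall (0 : Space n)
  obtain ⟨Ku, v, hv, huv⟩ := exists_lipschitzWith_eqOn_closedBall hu R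
  -- `u` is only locally Lipschitz, but on the support of `V` it may be replaced by a globally
  -- Lipschitz function.
  have hWv : ∀ x, ψ (u x) • V x = ψ (v x) • V x := by
    intro x
    by_cases hx : x ∈ tsupport V
    · rw [huv (hR hx)]
    · rw [image_eq_zero_of_notMem_tsupport hx, smul_zero, smul_zero]
  refine ⟨Mψ.toNNReal * LV + Lψ * Ku * MV.toNNReal, LipschitzWith.of_dist_le_mul fun x y => ?_⟩
  rw [dist_eq_norm, hWv, hWv]
  have h1 : ψ (v x) • V x - ψ (v y) • V y =
      ψ (v x) • (V x - V y) + (ψ (v x) - ψ (v y)) • V y := by module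
  have h2 := hLV.dist_le_mul x y
  have h3 := (hLψ.comp hv).dist_le_mul x y
  rw [dist_eq_norm] at h2 h3
  rw [h1]
  calc _ ≤ ‖ψ (v x)‖ * ‖V x - V y‖ + ‖ψ (v x) - ψ (v y)‖ * ‖V y‖ := by
        refine (norm_add_le _ _).trans ?_
        rw [norm_smul, norm_smul]
    _ ≤ Mψ.toNNReal * (LV * dist x y) + (Lψ * Ku : ℝ≥0) * dist x y * MV.toNNReal := by
        gcongr
        · exact (hMψ _).trans (Real.le_coe_toNNReal _)
        · exact h3
        · exact (hMV _).trans (Real.le_coe_toNNReal _)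
    _ = _ := by push_cast; ring

/-- Admissibility of the test field: its support lies in `{u > 0}`, whereas the closure of `{u < 0}`
lies in `{u ≤ 0}`. -/
theorem tsupport_comp_smul_subset {n : ℕ} {u : Space n → ℝ} (hu : Continuous u)
    (V : Space n → Space n) {ψ : ℝ → ℝ} (hψ0 : tsupport ψ ⊆ Ioi 0) :
    tsupport (fun x => ψ (u x) • V x) ⊆ (closure {x | u x < 0})ᶜ := by
  have h1 : tsupport (fun x => ψ (u x) • V x) ⊆ {x | u x ∈ tsupport ψ} := by
    refine closure_minimal (fun x hx => subset_tsupport _ fun h => hx ?_)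
      ((isClosed_tsupport ψ).preimage hu)
    beta_reduce
    rw [h, zero_smul]
  intro x hx hxE
  have h2 : 0 < u x := hψ0 (h1 hx)
  have h3 : closure {x | u x < 0} ⊆ {x | u x ≤ 0} :=
    closure_minimal (fun y (hy : u y < 0) => (hy.le : u y ≤ 0)) (isClosed_le hu continuous_const)
  exact not_lt.2 (h3 hxE) h2

/-- In the first variation with respect to `ψ(u) V`, the terms containing `ψ'` cancel. -/
theorem IsMinkowskiNorm.firstVariation_comp_smul {n : ℕ} {F : Space n → ℝ}
    (hF : IsMinkowskiNorm F) {u : Space n → ℝ} {V : Space n → Space n} {ψ : ℝ → ℝ} {x : Space n}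
    (hV : DifferentiableAt ℝ V x) (hψ : DifferentiableAt ℝ ψ (u x))
    (hu : DifferentiableAt ℝ u x) :
    F (gradient u x) * trace (fderiv ℝ (fun x => ψ (u x) • V x) x) -
      inner ℝ (gradient u x)
        (fderiv ℝ (fun x => ψ (u x) • V x) x (gradient F (gradient u x))) -
      F (gradient u x) * inner ℝ (gradient u x) (ψ (u x) • V x) =
    ‖fderiv ℝ u x‖ * (ψ (u x) * levelIntegrand F u V x) := by
  have hW : fderiv ℝ (fun x => ψ (u x) • V x) x =
      ψ (u x) • fderiv ℝ V x + (deriv ψ (u x) • fderiv ℝ u x).smulRight (V x) :=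
    ((hψ.hasDerivAt.comp_hasFDerivAt x hu.hasFDerivAt).smul hV.hasFDerivAt).fderiv
  -- Up to the factor `ψ'(u)`, these are the contributions of the rank-one part of the derivative to
  -- the trace term and to the inner-product term.
  have hEuler : F (gradient u x) * inner ℝ (gradient u x) (V x) =
      inner ℝ (gradient u x) (gradient F (gradient u x)) * inner ℝ (gradient u x) (V x) := by
    rcases eq_or_ne (gradient u x) 0 with h | h
    · simp [h]
    · rw [real_inner_comm (gradient F _), inner_gradient F, hF.fderiv_apply_self h]
  rw [mul_left_comm, hF.norm_mul_levelIntegrand, hW, trace_add, trace_smul, trace_smulRight,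
    ContinuousLinearMap.add_apply, inner_add_right]
  simp only [ContinuousLinearMap.smul_apply, ContinuousLinearMap.smulRight_apply,
    real_inner_smul_right, ← inner_gradient u, smul_eq_mul]
  linear_combination deriv ψ (u x) * hEuler

/-- The first variation identity in the direction of `ψ(u) V`. -/
theorem IsMinkowskiNorm.integral_comp_mul_levelIntegrand {n : ℕ} {F : Space n → ℝ}
    (hF : IsMinkowskiNorm F) {u : Space n → ℝ} {E₀ : Set (Space n)}
    (hu : IsWeakSolutionWithInitialCondition F E₀ u) {V : Space n → Space n}
    (hV : ContDiff ℝ ∞ V) (hVc : HasCompactSupport V) {ψ : ℝ → ℝ} (hψ : ContDiff ℝ ∞ ψ)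
    (hψc : HasCompactSupport ψ) (hψ0 : tsupport ψ ⊆ Ioi 0) :
    ∫ x, ‖fderiv ℝ u x‖ * (ψ (u x) * levelIntegrand F u V x) = 0 := by
  have huL := hu.locallyLipschitz
  obtain ⟨L, hWL⟩ := exists_lipschitzWith_comp_smul huL hV hVc hψ hψc
  have hWc : HasCompactSupport fun x => ψ (u x) • V x := hVc.smul_left (f := fun x => ψ (u x))
  have hWΩ : tsupport (fun x => ψ (u x) • V x) ⊆ (closure E₀)ᶜ := by
    rw [hu.initial]
    exact tsupport_comp_smul_subset huL.continuous V hψ0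
  have hfirst := hF.integral_firstVariation_eq_zero huL hu.weakSolution hWL hWc hWΩ
  rw [setIntegral_eq_integral_of_forall_compl_eq_zero] at hfirst
  · rw [← hfirst]
    refine integral_congr_ae ?_
    filter_upwards [ae_differentiableAt_of_locallyLipschitz huL] with x hx
    exact (hF.firstVariation_comp_smul (hV.differentiable (by simp) x)
      (hψ.differentiable (by simp) _) hx).symm
  · intro x hx
    have h1 : fderiv ℝ (fun x => ψ (u x) • V x) x = 0 := fderiv_of_notMem_tsupport ℝ hx
    have h2 : ψ (u x) • V x = 0 :=
      image_eq_zero_of_notMem_tsupport (f := fun x => ψ (u x) • V x) hx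
    rw [h1, h2]
    simp [trace]


/-! ### Bounds and integrability of the level-set integrand -/

theorem measurable_clm_apply {n : ℕ} {f : Space n → Space n →L[ℝ] Space n}
    {g : Space n → Space n} (hf : Measurable f) (hg : Measurable g) :
    Measurable fun x => f x (g x) :=
  (isBoundedBilinearMap_apply (𝕜 := ℝ) (E := Space n) (F := Space n)).continuous.measurable.comp
    (hf.prodMk hg)

namespace IsMinkowskiNorm

variable {n : ℕ} {F : Space n → ℝ}

theorem measurable (hF : IsMinkowskiNorm F) : Measurable F :=
  hF.convex.locallyLipschitz.continuous.measurable

theorem measurable_weightedDivergence (hF : IsMinkowskiNorm F) (u : Space n → ℝ)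
    (V : Space n → Space n) : Measurable (weightedDivergence F u V) :=
  ((hF.measurable.comp (measurable_unitNormal u)).mul
    (continuous_trace.measurable.comp (measurable_fderiv ℝ V))).sub
    ((measurable_unitNormal u).inner (measurable_clm_apply (measurable_fderiv ℝ V)
      ((measurable_gradient F).comp (measurable_unitNormal u))))

theorem exists_abs_weightedDivergence_le (hF : IsMinkowskiNorm F) (u : Space n → ℝ) :
    ∃ C : ℝ≥0, ∀ V x, |weightedDivergence F u V x| ≤ C * ‖fderiv ℝ V x‖ := by
  obtain ⟨C, hC⟩ := hF.exists_lipschitzWith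
  have hFC : ∀ x, ‖x‖ ≤ 1 → |F x| ≤ C := by
    intro x hx
    have := hC.dist_le_mul x 0
    rw [dist_eq_norm, dist_eq_norm, hF.map_zero, sub_zero, sub_zero] at this
    exact this.trans (mul_le_of_le_one_right C.2 hx)
  have hgC : ∀ x, ‖gradient F x‖ ≤ C := fun x => by
    rw [norm_gradient]; exact norm_fderiv_le_of_lipschitz ℝ hC
  refine ⟨C * n + C, fun V x => ?_⟩
  have hν := norm_unitNormal_le u x
  have h1 : |F (unitNormal u x) * trace (fderiv ℝ V x)| ≤ C * (n * ‖fderiv ℝ V x‖) := by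
    rw [abs_mul]
    exact mul_le_mul (hFC _ hν) (abs_trace_le _) (abs_nonneg _) C.2
  have h2 : |inner ℝ (unitNormal u x) (fderiv ℝ V x (gradient F (unitNormal u x)))| ≤
      C * ‖fderiv ℝ V x‖ := by
    calc _ ≤ ‖unitNormal u x‖ * ‖fderiv ℝ V x (gradient F (unitNormal u x))‖ :=
          abs_real_inner_le_norm _ _
      _ ≤ 1 * (‖fderiv ℝ V x‖ * ‖gradient F (unitNormal u x)‖) :=
          mul_le_mul hν (ContinuousLinearMap.le_opNorm _ _) (norm_nonneg _) zero_le_one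
      _ ≤ 1 * (‖fderiv ℝ V x‖ * C) := by gcongr; exact hgC _
      _ = _ := by ring
  calc |weightedDivergence F u V x| ≤ C * (n * ‖fderiv ℝ V x‖) + C * ‖fderiv ℝ V x‖ :=
        (abs_sub _ _).trans (add_le_add h1 h2)
    _ = _ := by push_cast; ring

theorem exists_abs_gradient_le (hF : IsMinkowskiNorm F) {u : Space n → ℝ}
    (hu : LocallyLipschitz u) (R : ℝ) :
    ∃ C : ℝ≥0, ∀ x ∈ Metric.ball (0 : Space n) R, ‖gradient u x‖ ≤ C ∧ |F (gradient u x)| ≤ C := by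
  obtain ⟨K, hK⟩ := (hu.locallyLipschitzOn (s := Metric.closedBall 0 R)
    ).exists_lipschitzOnWith_of_compact (isCompact_closedBall 0 R)
  obtain ⟨C, hC⟩ := hF.exists_le_mul_norm
  refine ⟨K + C * K, fun x hx => ?_⟩
  have h1 : ‖gradient u x‖ ≤ K := norm_gradient_le_of_lipschitzOnWith Metric.isOpen_ball
    (hK.mono Metric.ball_subset_closedBall) hx
  have h2 : (C : ℝ) * ‖gradient u x‖ ≤ C * K := by gcongr
  rw [abs_of_nonneg (hF.nonneg _)]
  push_cast
  have h3 : (0 : ℝ) ≤ C * K := by positivity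
  have h4 : (0 : ℝ) ≤ K := K.2
  exact ⟨by linarith, by linarith [hC (gradient u x)]⟩

theorem measurable_levelIntegrand (hF : IsMinkowskiNorm F) (u : Space n → ℝ)
    {V : Space n → Space n} (hV : Continuous V) : Measurable (levelIntegrand F u V) :=
  (hF.measurable_weightedDivergence u V).sub
    ((hF.measurable.comp (measurable_gradient u)).mul
      (hV.measurable.inner (measurable_unitNormal u)))

/-- The constant does not depend on `V`; this is what lets the first variation identity pass to `C¹`
limits of vector fields. -/
theorem exists_abs_levelIntegrand_le (hF : IsMinkowskiNorm F) {u : Space n → ℝ}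
    (hu : LocallyLipschitz u) (R : ℝ) : ∃ C : ℝ≥0, ∀ V, ∀ x ∈ Metric.ball (0 : Space n) R,
      |levelIntegrand F u V x| ≤ C * (‖V x‖ + ‖fderiv ℝ V x‖) := by
  obtain ⟨C₁, hC₁⟩ := hF.exists_abs_weightedDivergence_le u
  obtain ⟨C₂, hC₂⟩ := hF.exists_abs_gradient_le hu R
  refine ⟨C₁ + C₂, fun V x hx => ?_⟩
  have h1 : |F (gradient u x) * inner ℝ (V x) (unitNormal u x)| ≤ C₂ * ‖V x‖ := by
    rw [abs_mul]
    refine mul_le_mul (hC₂ x hx).2 ?_ (abs_nonneg _) C₂.2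
    exact (abs_real_inner_le_norm _ _).trans
      (mul_le_of_le_one_right (norm_nonneg _) (norm_unitNormal_le u x))
  have h2 := (abs_sub _ _).trans (add_le_add (hC₁ V x) h1)
  refine h2.trans ?_
  push_cast
  have h3 : (0 : ℝ) ≤ C₁ * ‖V x‖ := by positivity
  have h4 : (0 : ℝ) ≤ C₂ * ‖fderiv ℝ V x‖ := by positivity
  nlinarith

end IsMinkowskiNorm

theorem levelIntegrand_eq_zero {n : ℕ} (F u : Space n → ℝ) {V : Space n → Space n} {x : Space n}
    (hx : x ∉ tsupport V) : levelIntegrand F u V x = 0 := by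
  simp [levelIntegrand, weightedDivergence, fderiv_of_notMem_tsupport ℝ hx, trace,
    image_eq_zero_of_notMem_tsupport hx]

theorem levelIntegrand_sub {n : ℕ} (F u : Space n → ℝ) {V V' : Space n → Space n}
    (hV : Differentiable ℝ V) (hV' : Differentiable ℝ V') (x : Space n) :
    levelIntegrand F u (V - V') x = levelIntegrand F u V x - levelIntegrand F u V' x := by
  rw [levelIntegrand, levelIntegrand, levelIntegrand, weightedDivergence, weightedDivergence,
    weightedDivergence, fderiv_sub (hV x) (hV' x), trace_sub, ContinuousLinearMap.sub_apply,
    inner_sub_right, Pi.sub_apply, inner_sub_left]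
  ring

/-- A bounded measurable function supported in a set of finite measure is integrable. -/
theorem integrable_of_bound_of_support {X : Type*} [MeasurableSpace X] {μ : Measure X}
    {f : X → ℝ} (hf : Measurable f) {C : ℝ} {s : Set X} (hs : MeasurableSet s) (hμ : μ s < ⊤)
    (hC : ∀ x ∈ s, |f x| ≤ C) (h0 : ∀ x ∉ s, f x = 0) : Integrable f μ := by
  have h1 : IntegrableOn f s μ := IntegrableOn.of_bound hμ hf.aestronglyMeasurable C
    ((ae_restrict_mem hs).mono fun x hx => hC x hx)
  exact h1.integrable_of_forall_notMem_eq_zero h0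

theorem exists_bound_of_contDiff {n : ℕ} {V : Space n → Space n} (hV : ContDiff ℝ ∞ V)
    (hVc : HasCompactSupport V) : ∃ M : ℝ, ∀ x, ‖V x‖ + ‖fderiv ℝ V x‖ ≤ M := by
  obtain ⟨M₁, h₁⟩ := hV.continuous.bounded_above_of_compact_support hVc
  obtain ⟨M₂, h₂⟩ := (hV.continuous_fderiv (by simp)).bounded_above_of_compact_support
    (hVc.fderiv ℝ)
  exact ⟨M₁ + M₂, fun x => add_le_add (h₁ x) (h₂ x)⟩

theorem IsMinkowskiNorm.integrable_levelIntegrand {n : ℕ} {F : Space n → ℝ}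
    (hF : IsMinkowskiNorm F) {u : Space n → ℝ} (hu : LocallyLipschitz u) {μ : Measure (Space n)}
    (hμ : ∀ R : ℝ, μ (Metric.closedBall 0 R) < ⊤) {V : Space n → Space n} (hV : ContDiff ℝ ∞ V)
    (hVc : HasCompactSupport V) : Integrable (levelIntegrand F u V) μ := by
  obtain ⟨R, hR⟩ := hVc.isCompact.isBounded.subset_ball (0 : Space n)
  obtain ⟨C, hC⟩ := hF.exists_abs_levelIntegrand_le hu R
  obtain ⟨M, hM⟩ := exists_bound_of_contDiff hV hVc
  refine integrable_of_bound_of_support (hF.measurable_levelIntegrand u hV.continuous)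
    (C := C * M) Metric.isOpen_ball.measurableSet
    ((measure_mono Metric.ball_subset_closedBall).trans_lt (hμ R)) (fun x hx => ?_)
    fun x hx => levelIntegrand_eq_zero F u fun h => hx (hR h)
  exact (hC V x hx).trans (by gcongr; exact hM x)

/-! ### The first variation identity on almost every level set -/

/-- For a fixed vector field, the first variation identity holds on almost every level set. -/
theorem IsMinkowskiNorm.ae_integral_levelIntegrand_eq_zero {m : ℕ} {F : Space (m + 1) → ℝ}
    (hF : IsMinkowskiNorm F) {u : Space (m + 1) → ℝ} {E₀ : Set (Space (m + 1))}
    (hu : IsWeakSolutionWithInitialCondition F E₀ u) {V : Space (m + 1) → Space (m + 1)}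
    (hV : ContDiff ℝ ∞ V) (hVc : HasCompactSupport V) :
    ∀ᵐ t : ℝ, 0 < t → ∫ x, levelIntegrand F u V x ∂(levelMeasure u t) = 0 := by
  obtain ⟨c, hc0, hc⟩ := exists_lintegral_hausdorffMeasure_slice m
  have huL := hu.locallyLipschitz
  have hcont := huL.continuous
  obtain ⟨R, hR⟩ := hVc.isCompact.isBounded.subset_ball (0 : Space (m + 1))
  obtain ⟨C, hC⟩ := hF.exists_abs_levelIntegrand_le huL R
  obtain ⟨C', hC'⟩ := hF.exists_abs_gradient_le huL R
  obtain ⟨M, hM⟩ := exists_bound_of_contDiff hV hVc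
  -- Needed twice: with `f = 1` for the integrability in `t` of the level integrals, and with `f =
  -- ψ(u)` for the coarea formula.
  have hint : ∀ f : Space (m + 1) → ℝ, Measurable f → ∀ Mf, (∀ x, |f x| ≤ Mf) →
      Integrable fun x => ‖fderiv ℝ u x‖ * (f x * levelIntegrand F u V x) := by
    intro f hf Mf hMf
    refine integrable_of_bound_of_support (C := C' * (Mf * (C * M)))
      ((measurable_fderiv ℝ u).norm.mul (hf.mul (hF.measurable_levelIntegrand u hV.continuous)))
      Metric.isOpen_ball.measurableSet (Metric.isBounded_ball (x := 0) (r := R)).measure_lt_top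
      (fun x hx => ?_) fun x hx => by
        rw [levelIntegrand_eq_zero F u fun h => hx (hR h), mul_zero, mul_zero]
    rw [abs_mul, abs_mul, abs_norm, ← norm_gradient]
    have h1 : |levelIntegrand F u V x| ≤ C * M := (hC V x hx).trans (by gcongr; exact hM x)
    exact mul_le_mul (hC' x hx).1 (mul_le_mul (hMf x) h1 (abs_nonneg _)
      ((abs_nonneg _).trans (hMf x))) (by positivity) C'.2
  have hG : Integrable fun t => ∫ x, levelIntegrand F u V x ∂(levelMeasure u t) := by
    have := hint (fun _ => 1) measurable_const 1 (by simp)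
    simp only [one_mul] at this
    exact (integral_coarea hc hcont this).1
  refine isOpen_Ioi.ae_eq_zero_of_integral_contDiff_smul_eq_zero
    (hG.locallyIntegrable.locallyIntegrableOn _) fun ψ hψ hψc hψ0 => ?_
  obtain ⟨Mψ, hMψ⟩ := hψ.continuous.bounded_above_of_compact_support hψc
  have h1 := (integral_coarea hc hcont (hint (fun x => ψ (u x))
    (hψ.continuous.comp hcont).measurable Mψ fun x => hMψ _)).2
  rw [hF.integral_comp_mul_levelIntegrand hu hV hVc hψ hψc hψ0, mul_zero] at h1
  rw [← h1]
  refine integral_congr_ae (Eventually.of_forall fun t => ?_)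
  beta_reduce
  rw [smul_eq_mul, ← integral_const_mul]
  refine integral_congr_ae ?_
  have hmeas : MeasurableSet (regularPoints u ∩ {x | u x = t}) :=
    (measurableSet_regularPoints u).inter (isClosed_eq hcont continuous_const).measurableSet
  filter_upwards [ae_restrict_mem hmeas] with x hx
  rw [show u x = t from hx.2]

/-- The smooth vector fields supported in a ball are separable in the `C¹` topology. -/
theorem exists_countable_dense_vectorFields (n : ℕ) (R : ℝ) :
    ∃ V : ℕ → Space n → Space n,
      (∀ i, ContDiff ℝ ∞ (V i) ∧ tsupport (V i) ⊆ Metric.closedBall 0 R) ∧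
      ∀ W : Space n → Space n, ContDiff ℝ ∞ W → tsupport W ⊆ Metric.closedBall 0 R →
        ∀ ε > 0, ∃ i, ∀ x ∈ Metric.closedBall (0 : Space n) R,
          ‖W x - V i x‖ ≤ ε ∧ ‖fderiv ℝ W x - fderiv ℝ (V i) x‖ ≤ ε := by
  let X := {V : Space n → Space n // ContDiff ℝ ∞ V ∧ tsupport V ⊆ Metric.closedBall 0 R}
  -- The pair `(V, DV)` places the fields in the separable metric space of continuous maps on a
  -- compact ball. Subsets of it are again separable, so a dense sequence can be chosen among the
  -- fields themselves.
  let J : X → C(Metric.closedBall (0 : Space n) R, Space n × (Space n →L[ℝ] Space n)) := fun V =>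
    ⟨fun x => (V.1 x, fderiv ℝ V.1 x), by
      have h1 := V.2.1.continuous
      have h2 := V.2.1.continuous_fderiv (by simp)
      fun_prop⟩
  have : CompactSpace (Metric.closedBall (0 : Space n) R) :=
    isCompact_iff_compactSpace.1 (isCompact_closedBall 0 R)
  have : Nonempty (range J) := ⟨⟨J ⟨0, contDiff_const, by simp [tsupport]⟩, mem_range_self _⟩⟩
  choose P hP using fun i => (TopologicalSpace.denseSeq (range J) i).2
  refine ⟨fun i => (P i).1, fun i => (P i).2, fun W hW hWR ε hε => ?_⟩
  obtain ⟨i, hi⟩ := (TopologicalSpace.denseRange_denseSeq (range J)).exists_mem_open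
    (s := Subtype.val ⁻¹' Metric.ball (J ⟨W, hW, hWR⟩) ε)
    (Metric.isOpen_ball.preimage continuous_subtype_val)
    ⟨⟨J ⟨W, hW, hWR⟩, mem_range_self _⟩, Metric.mem_ball_self hε⟩
  refine ⟨i, fun x hx => ?_⟩
  have h1 : dist (J ⟨W, hW, hWR⟩) (J (P i)) < ε := by
    rw [hP, dist_comm]; exact hi
  have h2 := (ContinuousMap.dist_apply_le_dist (f := J ⟨W, hW, hWR⟩)
    (g := J (P i)) ⟨x, hx⟩).trans h1.le
  rw [Prod.dist_eq, max_le_iff, dist_eq_norm, dist_eq_norm] at h2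
  exact h2

/-- The first variation identity holds on almost every level set for all vector fields. -/
theorem IsMinkowskiNorm.ae_forall_integral_levelIntegrand_eq_zero {m : ℕ}
    {F : Space (m + 1) → ℝ} (hF : IsMinkowskiNorm F) {u : Space (m + 1) → ℝ}
    {E₀ : Set (Space (m + 1))} (hu : IsWeakSolutionWithInitialCondition F E₀ u) :
    ∀ᵐ t : ℝ, 0 < t → (∀ R : ℝ, levelMeasure u t (Metric.closedBall 0 R) < ⊤) →
      ∀ V : Space (m + 1) → Space (m + 1), ContDiff ℝ ∞ V → HasCompactSupport V →
        ∫ x, levelIntegrand F u V x ∂(levelMeasure u t) = 0 := by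
  have huL := hu.locallyLipschitz
  choose V hV hVd using fun k : ℕ => exists_countable_dense_vectorFields (m + 1) k
  have hVc : ∀ k i, HasCompactSupport (V k i) := fun k i =>
    HasCompactSupport.of_support_subset_isCompact (isCompact_closedBall 0 (k : ℝ))
      ((subset_tsupport _).trans (hV k i).2)
  have hall : ∀ᵐ t : ℝ, ∀ k i, 0 < t →
      ∫ x, levelIntegrand F u (V k i) x ∂(levelMeasure u t) = 0 :=
    ae_all_iff.2 fun k => ae_all_iff.2 fun i =>
      hF.ae_integral_levelIntegrand_eq_zero hu (hV k i).1 (hVc k i)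
  filter_upwards [hall] with t ht ht0 hfin W hW hWc
  obtain ⟨R, hR⟩ := hWc.isCompact.isBounded.subset_closedBall (0 : Space (m + 1))
  obtain ⟨k, hk⟩ := exists_nat_gt R
  have hWk : tsupport W ⊆ Metric.closedBall 0 (k : ℝ) :=
    hR.trans (Metric.closedBall_subset_closedBall hk.le)
  obtain ⟨C, hC⟩ := hF.exists_abs_levelIntegrand_le huL (k + 1)
  set μ := levelMeasure u t
  set B := Metric.closedBall (0 : Space (m + 1)) k with hB
  -- The identity already holds for `V k i`, so `W` may be replaced by `W - V k i`, which is at most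
  -- `ε` on the ball together with its derivative and vanishes outside.
  have hbound : ∀ ε > 0, |∫ x, levelIntegrand F u W x ∂μ| ≤ (C * (ε + ε)) * μ.real B := by
    intro ε hε
    obtain ⟨i, hi⟩ := hVd k W hW hWk ε hε
    have h1 : ∫ x, levelIntegrand F u W x ∂μ = ∫ x in B, levelIntegrand F u (W - V k i) x ∂μ := by
      rw [setIntegral_eq_integral_of_forall_compl_eq_zero]
      · simp_rw [levelIntegrand_sub F u (hW.differentiable (by simp))
          ((hV k i).1.differentiable (by simp))]
        rw [integral_sub (hF.integrable_levelIntegrand huL hfin hW hWc)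
          (hF.integrable_levelIntegrand huL hfin (hV k i).1 (hVc k i)), ht k i ht0, sub_zero]
      · intro x hx
        rw [levelIntegrand_sub F u (hW.differentiable (by simp))
          ((hV k i).1.differentiable (by simp)), levelIntegrand_eq_zero F u fun h => hx (hWk h),
          levelIntegrand_eq_zero F u fun h => hx ((hV k i).2 h), sub_zero]
    rw [h1, ← Real.norm_eq_abs]
    refine norm_setIntegral_le_of_norm_le_const (hfin k) fun x hx => ?_
    have hx' : x ∈ Metric.ball (0 : Space (m + 1)) (k + 1) :=
      Metric.closedBall_subset_ball (by linarith) hx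
    refine (hC (W - V k i) x hx').trans ?_
    rw [fderiv_sub (hW.differentiable (by simp) x) ((hV k i).1.differentiable (by simp) x)]
    gcongr
    · exact (hi x hx).1
    · exact (hi x hx).2
  have hlim : Tendsto (fun ε : ℝ => (C * (ε + ε)) * μ.real B) (𝓝[>] 0) (𝓝 0) := by
    have : Tendsto (fun ε : ℝ => (C * (ε + ε)) * μ.real B) (𝓝 0)
        (𝓝 ((C * ((0 : ℝ) + 0)) * μ.real B)) := by
      apply Continuous.tendsto; fun_prop
    simp only [add_zero, mul_zero, zero_mul] at this
    exact this.mono_left nhdsWithin_le_nhds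
  have h0 : |∫ x, levelIntegrand F u W x ∂μ| ≤ 0 :=
    ge_of_tendsto hlim (eventually_mem_nhdsWithin.mono fun ε hε => hbound ε hε)
  exact abs_nonpos_iff.1 h0

/-! ### Uniqueness and conclusion -/

/-- The weak anisotropic mean curvature is unique up to null sets. -/
theorem IsWeakAnisotropicMeanCurvature.ae_eq {n : ℕ} {F : Space n → ℝ} {E : Set (Space n)}
    {H H' : Space n → ℝ} (h : IsWeakAnisotropicMeanCurvature F E H)
    (h' : IsWeakAnisotropicMeanCurvature F E H') :
    ∀ᵐ x ∂(surfaceMeasure (frontier E)), H x = H' x := by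
  obtain ⟨-, hH, ν, hνm, hν, hint⟩ := h
  obtain ⟨-, hH', ν', hν'm, hν', hint'⟩ := h'
  have hνν' : ∀ᵐ x ∂(surfaceMeasure (frontier E)), ν' x = ν x := by
    filter_upwards [hν, hν'] with x h1 h2
    exact h2.eq h1
  have hloc : ∀ (G : Space n → ℝ), LocallyIntegrable G (surfaceMeasure (frontier E)) →
      ∀ i, LocallyIntegrable (fun x => G x * ν x i) (surfaceMeasure (frontier E)) := by
    intro G hG i
    refine hG.mono (hG.aestronglyMeasurable.mul
      ((EuclideanSpace.proj (𝕜 := ℝ) i).continuous.comp_aestronglyMeasurable hνm)) ?_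
    filter_upwards [hν] with x hx
    rw [norm_mul]
    refine mul_le_of_le_one_right (norm_nonneg _) ?_
    rw [← hx.1]
    exact PiLp.norm_apply_le _ _
  -- The two normals agree almost everywhere, hence so do the left-hand sides. Testing with `g • eᵢ`
  -- then identifies `Hνᵢ` with `H'νᵢ`, and at almost every point some `νᵢ` is nonzero.
  have hi : ∀ i, ∀ᵐ x ∂(surfaceMeasure (frontier E)), H x * ν x i = H' x * ν x i := by
    intro i
    refine ae_eq_of_integral_contDiff_smul_eq (hloc H hH i) (hloc H' hH' i) fun g hg hgc => ?_
    let V : Space n → Space n := fun x => g x • EuclideanSpace.single i 1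
    have hV : ContDiff ℝ ∞ V := hg.smul contDiff_const
    have hVc : HasCompactSupport V := hgc.smul_right
    have hVν : ∀ x w : Space n, inner ℝ (V x) w = g x * w i := by
      intro x w
      simp only [V, real_inner_smul_left, EuclideanSpace.inner_single_left, map_one, one_mul]
    have h1 := hint V hV hVc
    have h2 := hint' V hV hVc
    have h3 : ∫ x, tangentialDivergence F V x (ν' x) * F (ν' x) ∂(surfaceMeasure (frontier E)) =
        ∫ x, tangentialDivergence F V x (ν x) * F (ν x) ∂(surfaceMeasure (frontier E)) :=
      integral_congr_ae (hνν'.mono fun x hx => by simp only [hx])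
    have h4 : ∫ x, H' x * inner ℝ (V x) (ν' x) ∂(surfaceMeasure (frontier E)) =
        ∫ x, H' x * inner ℝ (V x) (ν x) ∂(surfaceMeasure (frontier E)) :=
      integral_congr_ae (hνν'.mono fun x hx => by simp only [hx])
    rw [h3, h4, h1] at h2
    simp_rw [hVν] at h2
    simp_rw [smul_eq_mul]
    convert h2 using 3 <;> ring
  filter_upwards [ae_all_iff.2 hi, hν] with x hx hxν
  have hne : ν x ≠ 0 := norm_ne_zero_iff.1 (by rw [hxν.1]; exact one_ne_zero)
  obtain ⟨i, hi0⟩ : ∃ i, ν x i ≠ 0 := by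
    by_contra hcon
    push Not at hcon
    exact hne (by ext i; simpa using hcon i)
  exact mul_right_cancel₀ hi0 (hx i)

theorem IsMinkowskiNorm.isWeakAnisotropicMeanCurvature_level {m : ℕ} {F : Space (m + 1) → ℝ}
    (hF : IsMinkowskiNorm F) {u : Space (m + 1) → ℝ} (hu : LocallyLipschitz u) {t : ℝ}
    (hμ : surfaceMeasure (frontier {y | u y < t}) = levelMeasure u t)
    (hfin : ∀ R : ℝ, levelMeasure u t (Metric.closedBall 0 R) < ⊤)
    (hV : ∀ V : Space (m + 1) → Space (m + 1), ContDiff ℝ ∞ V → HasCompactSupport V →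
        ∫ x, levelIntegrand F u V x ∂(levelMeasure u t) = 0) :
    (∀ᵐ x ∂(surfaceMeasure (frontier {y | u y < t})), DifferentiableAt ℝ u x) ∧
      IsWeakAnisotropicMeanCurvature F {y | u y < t} (fun x => F (gradient u x)) := by
  have hmem : ∀ᵐ x ∂(levelMeasure u t), x ∈ regularPoints u ∩ {x | u x = t} :=
    ae_restrict_mem ((measurableSet_regularPoints u).inter
      (isClosed_eq hu.continuous continuous_const).measurableSet)
  have hFu : Measurable fun x => F (gradient u x) := hF.measurable.comp (measurable_gradient u)
  rw [IsWeakAnisotropicMeanCurvature, hμ]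
  refine ⟨hmem.mono fun x hx => hx.1.1, ⟨fun x => ?_⟩, fun x => ?_, unitNormal u,
    (measurable_unitNormal u).aestronglyMeasurable, ?_, fun V hVs hVc => ?_⟩
  · exact ⟨Metric.ball 0 (‖x‖ + 1), Metric.isOpen_ball.mem_nhds (by simp),
      (measure_mono Metric.ball_subset_closedBall).trans_lt (hfin _)⟩
  · obtain ⟨C, hC⟩ := hF.exists_abs_gradient_le hu (‖x‖ + 1)
    refine ⟨Metric.ball 0 (‖x‖ + 1), Metric.isOpen_ball.mem_nhds (by simp), ?_⟩
    exact IntegrableOn.of_bound ((measure_mono Metric.ball_subset_closedBall).trans_lt (hfin _))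
      hFu.aestronglyMeasurable C
      ((ae_restrict_mem Metric.isOpen_ball.measurableSet).mono fun y hy => (hC y hy).2)
  · filter_upwards [hmem] with x hx
    have := isOuterUnitNormal_unitNormal hx.1
    rwa [show u x = t from hx.2] at this
  · have h1 : ∫ x, tangentialDivergence F V x (unitNormal u x) * F (unitNormal u x)
        ∂(levelMeasure u t) = ∫ x, weightedDivergence F u V x ∂(levelMeasure u t) :=
      integral_congr_ae (hmem.mono fun x hx => hF.tangentialDivergence_mul V hx.1)
    obtain ⟨R, hR⟩ := hVc.isCompact.isBounded.subset_ball (0 : Space (m + 1))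
    obtain ⟨C, hC⟩ := hF.exists_abs_weightedDivergence_le u
    obtain ⟨M, hM⟩ := exists_bound_of_contDiff hVs hVc
    have hi1 : Integrable (weightedDivergence F u V) (levelMeasure u t) := by
      refine integrable_of_bound_of_support (hF.measurable_weightedDivergence u V) (C := C * M)
        Metric.isOpen_ball.measurableSet
        ((measure_mono Metric.ball_subset_closedBall).trans_lt (hfin R)) (fun x _ => ?_)
        fun x hx => ?_
      · refine (hC V x).trans ?_
        gcongr
        linarith [hM x, norm_nonneg (V x)]
      · simp [weightedDivergence, fderiv_of_notMem_tsupport ℝ fun h => hx (hR h), trace]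
    have hi2 : Integrable (fun x => F (gradient u x) * inner ℝ (V x) (unitNormal u x))
        (levelMeasure u t) := by
      -- The curvature term is the difference of two integrable functions, so the vanishing integral
      -- of `levelIntegrand` splits into the two sides of the identity.
      have h2 := hi1.sub (hF.integrable_levelIntegrand hu hfin hVs hVc)
      refine h2.congr (Eventually.of_forall fun x => ?_)
      simp [levelIntegrand]
    have h2 := hV V hVs hVc
    unfold levelIntegrand at h2
    rw [integral_sub hi1 hi2] at h2
    rw [h1]
    exact sub_eq_zero.1 h2

theorem IsMinkowskiNorm.ae_isWeakAnisotropicMeanCurvature {n : ℕ} {F : Space n → ℝ}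
    (hF : IsMinkowskiNorm F) {u : Space n → ℝ} {E₀ : Set (Space n)}
    (hu : IsWeakSolutionWithInitialCondition F E₀ u) :
    ∀ᵐ t : ℝ, 0 < t →
      (∀ᵐ x ∂(surfaceMeasure (frontier {y | u y < t})), DifferentiableAt ℝ u x) ∧
      IsWeakAnisotropicMeanCurvature F {y | u y < t} (fun x => F (gradient u x)) := by
  cases n with
  | zero =>
    -- In dimension zero every set is clopen, so the frontier is empty and all assertions concern
    -- the zero measure.
    refine Eventually.of_forall fun t _ => ?_
    have h0 : surfaceMeasure (frontier {y | u y < t}) = 0 := by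
      have : frontier {y | u y < t} = ∅ := (isClopen_discrete _).frontier_eq
      rw [this, surfaceMeasure, Measure.restrict_empty]
    rw [IsWeakAnisotropicMeanCurvature, h0]
    exact ⟨by simp, inferInstance, fun x => ⟨univ, univ_mem, by simp [IntegrableOn]⟩, 0,
      aestronglyMeasurable_zero_measure _, by simp, by simp⟩
  | succ m =>
    obtain ⟨c, -, hc⟩ := exists_lintegral_hausdorffMeasure_slice m
    filter_upwards [hF.ae_forall_integral_levelIntegrand_eq_zero hu,
      ae_isLocallyFiniteMeasure_levelMeasure hc hu.locallyLipschitz,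
      ae_hausdorffMeasure_level_diff_regularPoints hu.locallyLipschitz] with t h1 h2 h3 ht
    exact hF.isWeakAnisotropicMeanCurvature_level hu.locallyLipschitz
      (surfaceMeasure_frontier_eq_levelMeasure hu.locallyLipschitz.continuous h3) h2 (h1 ht h2)

end IAMCF

theorem mainTheorem4 (n : ℕ) (F : IAMCF.Space n → ℝ) (hF : IAMCF.IsMinkowskiNorm F)
    (E₀ : Set (IAMCF.Space n)) (u : IAMCF.Space n → ℝ)
    (hu : IAMCF.IsWeakSolutionWithInitialCondition F E₀ u) :
    ∀ᵐ t : ℝ, 0 < t →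
      (∀ᵐ x ∂(IAMCF.surfaceMeasure (frontier {y | u y < t})), DifferentiableAt ℝ u x) ∧
      IAMCF.IsWeakAnisotropicMeanCurvature F {y | u y < t} (fun x => F (gradient u x)) ∧
      ∀ H : IAMCF.Space n → ℝ, IAMCF.IsWeakAnisotropicMeanCurvature F {y | u y < t} H →
        ∀ᵐ x ∂(IAMCF.surfaceMeasure (frontier {y | u y < t})), H x = F (gradient u x) := by
  filter_upwards [hF.ae_isWeakAnisotropicMeanCurvature hu] with t h ht
  exact ⟨(h ht).1, (h ht).2, fun H hH => hH.ae_eq (h ht).2⟩
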